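/- Let $n\ge 2$ and let $M$ be a connected, oriented, aspherical hyperbolic $n$-manifold, with or without boundary and not necessarily complete: $M$ is a smooth $n$-manifold covered by smooth immersed charts into hyperbolic space $\mathbb H^n$ that differ, near each point of an overlap, by an element of the group $\mathrm{Iso}_+(\mathbb H^n)$ of orientation preserving isometries, and its universal cover $p\colon X\to M$ is contractible. Let $G=\pi_1(M)$ act on $X$ by deck transformations, so that $M=X/G$. For a group $G$, $\mathrm H_b^\bullet(G)$ is the cohomology of the complex of bounded $G$-invariant functions $G^{k+1}\to\mathbb R$; for a space $M$, $\mathrm H_b^\bullet(M)$ is the cohomology of the complex $C_b^\bullet(M)$ of bounded functions on singular simplices of $M$; both carry the seminorm induced by the supremum norm, and $C_b^\bullet(M)$ is identified, through $p$, with the $G$-invariant part of $C_b^\bullet(X)$. Let $\mathrm{dev}\colon X\to\mathbb H^n$ be a developing map (an orientation preserving local isometry which near every point is a chart followed by an element of $\mathrm{Iso}_+(\mathbb H^n)$; for instance the inclusion if $X\subset\mathbb H^n$), equivariant with respect to the holonomy $\rho\colon G\to\mathrm{Iso}_+(\mathbb H^n)$. For points $x_0,\dots,x_n\in\mathbb H^n$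 let $\mathrm{vol}(x_0,\dots,x_n)$ be the signed volume $\int_\Delta vol_h$ of the geodesic simplex $\Delta$ with these vertices, parametrized by barycentric coordinates. Let $*\in\mathbb H^n$. Then such pairs $(\mathrm{dev},\rho)$ exist, and for all of them and all $*$ the formula $$v(g_0,\dots,g_n)=\mathrm{vol}(\rho(g_0)*,\dots,\rho(g_n)*)$$ defines a bounded invariant cocycle on $G$, and the formula $$v'(p\circ\sigma)=\mathrm{vol}(\mathrm{dev}\,\sigma(e_0),\dots,\mathrm{dev}\,\sigma(e_n))\qquad(\sigma\colon\Delta^n\to X\text{ a singular simplex with vertices }\sigma(e_i))$$ defines a bounded singular cocycle on $M$. The classes $Vol_M^{gp}=[v]\in \mathrm H_b^n(\pi_1(M))$ and $Vol_M=[v']\in \mathrm H_b^n(M)$ do not depend on the choices of $\mathrm{dev}$, $\rho$ and $*$. There is a canonical isometric isomorphism $r\colon \mathrm H_b^n(\pi_1(M))\to \mathrm H_b^n(M)$, namely the one induced by every $G$-equivariant cochain map $C_b^\bullet(G)\to C_b^\bullet(X)$ (where $C_b^k(G)$ is the space of all bounded functions on $G^{k+1}$) that is bounded in each degree and extends the identity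 of $\mathbb R$ on the augmentations (such maps exist), and $$r(Vol_M^{gp})=Vol_M .$$ -/

import Mathlib

open scoped Manifold ContDiff Topology

noncomputable section

namespace HypVol

/-! ## Bounded cochains and bounded cohomology -/

/-- Bounded real functions on a set `S`, with the supremum norm. -/
abbrev BddFun (S : Type*) : Type _ := lp (fun _ : S => ℝ) ⊤

/-- Composition of bounded functions with a map `u : T → S`. -/
def pullback {S T : Type*} (u : T → S) : BddFun S →ₗ[ℝ] BddFun T where
  toFun f := ⟨fun t => f (u t), memℓp_infty_iff.mpr
    ((memℓp_infty_iff.mp (lp.memℓp f)).mono (Set.range_comp_subset_range u fun s => ‖f s‖))⟩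
  map_add' _ _ := rfl
  map_smul' _ _ := rfl

@[simp] theorem pullback_apply {S T : Type*} (u : T → S) (f : BddFun S) (t : T) :
    pullback u f t = f (u t) := rfl

/-- The coboundary operator `(d f)(s) = ∑ i, (-1) ^ i * f (∂ᵢ s)` on bounded functions, for a
family of sets `S k` of `k`-simplices with face maps. -/
def coboundary {S : ℕ → Type*} (face : ∀ k, Fin (k + 2) → S (k + 1) → S k) (k : ℕ) :
    BddFun (S k) →ₗ[ℝ] BddFun (S (k + 1)) :=
  ∑ i : Fin (k + 2), (-1 : ℝ) ^ (i : ℕ) • pullback (face k i)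

section Cohomology

variable {S : ℕ → Type*} (face : ∀ k, Fin (k + 2) → S (k + 1) → S k)
  (V : ∀ k, Submodule ℝ (BddFun (S k)))

/-- The cocycles of degree `k` of the complex of bounded cochains belonging to `V`. -/
abbrev cocycles (k : ℕ) : Submodule ℝ (BddFun (S k)) :=
  V k ⊓ LinearMap.ker (coboundary face k)

/-- The coboundaries of degree `k` of the complex of bounded cochains belonging to `V`. -/
def coboundaries : ∀ k, Submodule ℝ (BddFun (S k))
  | 0 => ⊥
  | k + 1 => (V k).map (coboundary face k)

/-- Cocycles modulo coboundaries, with the quotient seminorm: the seminorm of a class is the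
infimum of the supremum norms of the cocycles that represent it. -/
abbrev Cohomology (k : ℕ) : Type _ :=
  cocycles face V k ⧸ (coboundaries face V k).submoduleOf (cocycles face V k)

/-- The class of a cocycle. -/
abbrev classOf {k : ℕ} (z : cocycles face V k) : Cohomology face V k :=
  Submodule.Quotient.mk z

end Cohomology

/-- The bounded functions that are invariant under the action of a group. -/
def invariants (G S : Type*) [Group G] [MulAction G S] : Submodule ℝ (BddFun S) where
  carrier := {f | ∀ (g : G) (s : S), f (g • s) = f s}
  zero_mem' _ _ := rfl
  add_mem' {f f'} hf hf' g s := by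
    change f (g • s) + f' (g • s) = f s + f' s
    rw [hf g s, hf' g s]
  smul_mem' c f hf g s := by
    change c * f (g • s) = c * f s
    rw [hf g s]

/-- The `i`-th face of a tuple of group elements: the `i`-th entry is omitted. -/
def groupFace (G : Type*) (k : ℕ) (i : Fin (k + 2)) (g : Fin (k + 2) → G) : Fin (k + 1) → G :=
  fun j => g (i.succAbove j)

/-- Singular `k`-simplices of `X`. -/
abbrev SingularSimplex (X : Type*) [TopologicalSpace X] (k : ℕ) : Type _ :=
  C(stdSimplex ℝ (Fin (k + 1)), X)

/-- The `i`-th face of a singular simplex. -/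
def singularFace (X : Type*) [TopologicalSpace X] (k : ℕ) (i : Fin (k + 2))
    (σ : SingularSimplex X (k + 1)) : SingularSimplex X k :=
  σ.comp ⟨stdSimplex.map i.succAbove, stdSimplex.continuous_map _⟩

/-- The invariant bounded cochains `G ^ (k + 1) → ℝ`, for the diagonal left translation action. -/
abbrev groupCochains (G : Type*) [Group G] (k : ℕ) : Submodule ℝ (BddFun (Fin (k + 1) → G)) :=
  invariants G (Fin (k + 1) → G)

/-- Bounded group cocycles. -/
abbrev GroupCocycle (G : Type*) [Group G] (k : ℕ) : Type _ :=
  cocycles (S := fun k => Fin (k + 1) → G) (groupFace G) (groupCochains G) k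

/-- The bounded cohomology `H_b^k(G)` of a discrete group with real coefficients. -/
abbrev HbGroup (G : Type*) [Group G] (k : ℕ) : Type _ :=
  Cohomology (S := fun k => Fin (k + 1) → G) (groupFace G) (groupCochains G) k

/-- The class in `H_b^k(G)` of a bounded cocycle. -/
abbrev groupClass {G : Type*} [Group G] {k : ℕ} (z : GroupCocycle G k) : HbGroup G k :=
  classOf (S := fun k => Fin (k + 1) → G) (groupFace G) (groupCochains G) z

/-- Bounded singular cocycles. -/
abbrev SingularCocycle (M : Type*) [TopologicalSpace M] (k : ℕ) : Type _ :=
  cocycles (S := SingularSimplex M) (singularFace M) (fun _ => ⊤) k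

/-- The bounded singular cohomology `H_b^k(M)` of a topological space with real coefficients. -/
abbrev HbSpace (M : Type*) [TopologicalSpace M] (k : ℕ) : Type _ :=
  Cohomology (S := SingularSimplex M) (singularFace M) (fun _ => ⊤) k

/-- The class in `H_b^k(M)` of a bounded singular cocycle. -/
abbrev singularClass {M : Type*} [TopologicalSpace M] {k : ℕ} (z : SingularCocycle M k) :
    HbSpace M k :=
  classOf (S := SingularSimplex M) (singularFace M) (fun _ => ⊤) z

/-! ## The canonical map from `H_b(G)` to `H_b(X / G)` -/

section Canonical

variable (G X : Type*) [Group G] [TopologicalSpace X] [MulAction G X] [ContinuousConstSMul G X]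

/-- A morphism from the augmented resolution `ℝ → C_b^0(G) → C_b^1(G) → ⋯` to the augmented complex
`ℝ → C_b^0(X) → C_b^1(X) → ⋯`: a `G`-equivariant cochain map, bounded in every degree, that extends
the identity of `ℝ`. -/
structure ResolutionMap where
  map : ∀ k, BddFun (Fin (k + 1) → G) →L[ℝ] BddFun (SingularSimplex X k)
  equivariant : ∀ (k : ℕ) (h : G) (f : BddFun (Fin (k + 1) → G)),
    map k (pullback (fun g => h⁻¹ • g) f) = pullback (fun σ => h⁻¹ • σ) (map k f)
  comm : ∀ (k : ℕ) (f : BddFun (Fin (k + 1) → G)),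
    map (k + 1) (coboundary (S := fun k => Fin (k + 1) → G) (groupFace G) k f) =
      coboundary (S := SingularSimplex X) (singularFace X) k (map k f)
  augmentation : ∀ (c : ℝ) (f : BddFun (Fin 1 → G)), (∀ g, f g = c) → ∀ σ, map 0 f σ = c

variable {G X} {M : Type*} [TopologicalSpace M]

/-- `r : H_b^k(G) → H_b^k(M)` is induced by `φ`, where the bounded cochains on `M = X / G` are
identified with the invariant bounded cochains on `X` through composition with `p : X → M`. -/
def ResolutionMap.Induces (φ : ResolutionMap G X) (p : C(X, M)) {k : ℕ}
    (r : HbGroup G k → HbSpace M k) : Prop :=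
  ∀ f : GroupCocycle G k, ∃ z : SingularCocycle M k,
    (∀ σ : SingularSimplex X k, z.1 (p.comp σ) = φ.map k f.1 σ) ∧
      r (groupClass f) = singularClass z

/-- `r` is the canonical map `H_b^k(G) → H_b^k(X / G)`: it is the map induced by each equivariant
bounded cochain map of augmented resolutions `C_b(G) → C_b(X)`, and there are such maps. -/
def IsCanonical (p : C(X, M)) {k : ℕ} (r : HbGroup G k → HbSpace M k) : Prop :=
  Nonempty (ResolutionMap G X) ∧ ∀ φ : ResolutionMap G X, φ.Induces p r

end Canonical

/-! ## Hyperbolic space (hyperboloid model) and signed volumes of geodesic simplices -/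

/-- The Lorentz form `x₀ y₀ - x₁ y₁ - ⋯ - xₙ yₙ`. Minus this form restricts to the hyperbolic
Riemannian metric on the hyperboloid. -/
def lorentz {n : ℕ} (x y : Fin (n + 1) → ℝ) : ℝ :=
  x 0 * y 0 - ∑ i : Fin n, x i.succ * y i.succ

/-- Hyperbolic `n`-space: the upper sheet of the hyperboloid `⟨x, x⟩ = 1`. -/
abbrev Hyp (n : ℕ) : Type := {x : Fin (n + 1) → ℝ // lorentz x x = 1 ∧ 0 < x 0}

/-- The group `Iso₊(ℍⁿ)` of orientation preserving isometries, which is the group `SO⁺(n, 1)` of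
linear automorphisms of determinant one that preserve the Lorentz form and the upper sheet. -/
def IsoPlus (n : ℕ) : Subgroup ((Fin (n + 1) → ℝ) ≃ₗ[ℝ] (Fin (n + 1) → ℝ)) where
  carrier := {g | (∀ x y, lorentz (g x) (g y) = lorentz x y) ∧
    (∀ x, lorentz x x = 1 → (0 < g x 0 ↔ 0 < x 0)) ∧ LinearEquiv.det g = 1}
  one_mem' := ⟨fun _ _ => rfl, fun _ _ => Iff.rfl, map_one _⟩
  mul_mem' {g h} hg hh := by
    refine ⟨fun x y => ?_, fun x hx => ?_, ?_⟩
    · exact (hg.1 (h x) (h y)).trans (hh.1 x y)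
    · exact (hg.2.1 (h x) ((hh.1 x x).trans hx)).trans (hh.2.1 x hx)
    · rw [map_mul, hg.2.2, hh.2.2, mul_one]
  inv_mem' {g} hg := by
    have key : ∀ x, g (g⁻¹ x) = x := fun x => g.apply_symm_apply x
    have hl : ∀ x y, lorentz (g⁻¹ x) (g⁻¹ y) = lorentz x y := fun x y => by
      rw [← hg.1, key, key]
    refine ⟨hl, fun x hx => ?_, by rw [map_inv, hg.2.2, inv_one]⟩
    have h := hg.2.1 (g⁻¹ x) ((hl x x).trans hx)
    rw [key] at h
    exact h.symm

instance (n : ℕ) : MulAction (IsoPlus n) (Hyp n) where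
  smul g x := ⟨g.1 x.1, (g.2.1 _ _).trans x.2.1, (g.2.2.1 _ x.2.1).mpr x.2.2⟩
  one_smul _ := rfl
  mul_smul _ _ _ := rfl

/-- The geodesic simplex with vertices `x i`, as a function of the barycentric coordinates `t`: the
point `∑ i, t i • x i` is projected radially to the hyperboloid. -/
def geodesicSimplex {n k : ℕ} (x : Fin (k + 1) → Hyp n) (t : Fin (k + 1) → ℝ) : Fin (n + 1) → ℝ :=
  (√(lorentz (∑ i, t i • (x i).1) (∑ i, t i • (x i).1)))⁻¹ • ∑ i, t i • (x i).1

/-- The hyperbolic volume form at the point `y` of the hyperboloid, evaluated on tangent vectors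
`v 0, …, v (n - 1)`: the determinant of the matrix with rows `y, v 0, …, v (n - 1)`. -/
def volForm {n : ℕ} (y : Fin (n + 1) → ℝ) (v : Fin n → Fin (n + 1) → ℝ) : ℝ :=
  Matrix.det (Matrix.of (Fin.cons y v : Fin (n + 1) → Fin (n + 1) → ℝ))

/-- The standard `n`-simplex in the coordinates `s = (t₁, …, tₙ)`, where `t₀ = 1 - t₁ - ⋯ - tₙ`. -/
def coordSimplex (n : ℕ) : Set (Fin n → ℝ) := {s | (∀ i, 0 ≤ s i) ∧ ∑ i, s i ≤ 1}

/-- The geodesic `n`-simplex in the coordinates `s = (t₁, …, tₙ)` of the standard simplex. -/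
def geodesicParam {n : ℕ} (x : Fin (n + 1) → Hyp n) (s : Fin n → ℝ) : Fin (n + 1) → ℝ :=
  geodesicSimplex x (Fin.cons (1 - ∑ i, s i) s)

/-- The signed volume of the geodesic simplex with vertices `x 0, …, x n`: the integral over the
standard simplex of the pull-back of the hyperbolic volume form. -/
def signedVol {n : ℕ} (x : Fin (n + 1) → Hyp n) : ℝ :=
  ∫ s in coordSimplex n, volForm (geodesicParam x s)
    (fun i => fderiv ℝ (geodesicParam x) s (Pi.single i 1))

/-! ## Hyperbolic manifolds, developing maps and volume classes -/

section Manifold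

variable {n : ℕ} {H : Type*} [TopologicalSpace H]
  (I : ModelWithCorners ℝ (EuclideanSpace ℝ (Fin n)) H)
  (M : Type*) [TopologicalSpace M] [ChartedSpace H M]

/-- A hyperbolic chart: a smooth immersion of an open subset of the `n`-manifold `M` to `ℍⁿ`. -/
structure HyperbolicChart where
  source : Set M
  open_source : IsOpen source
  toFun : M → Hyp n
  smooth : ContMDiffOn I 𝓘(ℝ, Fin (n + 1) → ℝ) ∞ (fun x => (toFun x).1) source
  immersion : ∀ x ∈ source,
    Function.Injective (mfderiv I 𝓘(ℝ, Fin (n + 1) → ℝ) (fun x => (toFun x).1) x)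

/-- An oriented hyperbolic structure on the `n`-manifold `M` (with or without boundary, complete or
not): hyperbolic charts that cover `M` and that differ, near each point of an overlap, by an
orientation preserving isometry of `ℍⁿ`. The hyperbolic metrics and the orientations that are
pulled back by the charts agree on the overlaps, so `M` is an oriented Riemannian manifold that is
locally isometric to `ℍⁿ`, and the charts are orientation preserving local isometries. -/
structure HyperbolicStructure where
  charts : Set (HyperbolicChart I M)
  cover : ∀ x : M, ∃ c ∈ charts, x ∈ c.source
  compat : ∀ c ∈ charts, ∀ c' ∈ charts, ∀ x ∈ c.source ∩ c'.source,
    ∃ g : IsoPlus n, ∀ᶠ y in 𝓝 x, c'.toFun y = g • c.toFun y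

variable {I M} {G X : Type*} [Group G] [TopologicalSpace X] [MulAction G X]

/-- `dev : X → ℍⁿ` is a developing map of the hyperbolic structure, with holonomy `ρ`, on the
covering `p : X → M` whose group of deck transformations is `G`: it is an orientation preserving
local isometry (locally a chart followed by an element of `Iso₊(ℍⁿ)`), and it is `ρ`-equivariant. -/
structure IsDevelopment (𝓢 : HyperbolicStructure I M) (p : C(X, M)) (dev : X → Hyp n)
    (ρ : G →* IsoPlus n) : Prop where
  local_chart : ∀ c ∈ 𝓢.charts, ∀ x : X, p x ∈ c.source →
    ∃ g : IsoPlus n, ∀ᶠ y in 𝓝 x, dev y = g • c.toFun (p y)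
  equivariant : ∀ (γ : G) (x : X), dev (γ • x) = ρ γ • dev x

/-- `a` is the group volume class: it is represented by the bounded cocycle
`(g₀, …, gₙ) ↦` signed volume of the geodesic simplex with vertices `ρ(g₀) o, …, ρ(gₙ) o`. -/
def IsGroupVolumeClass (ρ : G →* IsoPlus n) (o : Hyp n) (a : HbGroup G n) : Prop :=
  ∃ v : GroupCocycle G n,
    (∀ g : Fin (n + 1) → G, v.1 g = signedVol fun i => ρ (g i) • o) ∧ a = groupClass v

/-- `b` is the topological volume class: it is represented by the bounded singular cocycle on `M`
whose value on `p ∘ σ`, for a singular simplex `σ` in the cover `X`, is the signed volume of the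
straightening of `dev ∘ σ`, the geodesic simplex with the same vertices. -/
def IsVolumeClass (p : C(X, M)) (dev : X → Hyp n) (b : HbSpace M n) : Prop :=
  ∃ v : SingularCocycle M n,
    (∀ σ : SingularSimplex X n,
      v.1 (p.comp σ) = signedVol fun i => dev (σ (stdSimplex.vertex i))) ∧
    b = singularClass v

end Manifold

end HypVol

end

open HypVol

/-! ### Homological algebra of bounded cochains. -/

noncomputable section

namespace HypVol

/-! ## Bounded functions -/

section BddFun

variable {S T : Type*}

/-! Both volume cocycles are pull-backs of one function, `signedVol`, on `(n + 1)`-tuples of points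
of hyperbolic space. The theorem follows once this function is known to be a bounded invariant
cocycle, and once pull-backs along different equivariant vertex maps are known to be cohomologous.

Analysis. Let `q` be the quadratic form of the Gram matrix of the vertices. The pulled-back volume
form is the determinant of the vertices times `q ^ (-(n + 1) / 2)`, because the derivative of the
radial factor only adds multiples of the position vector (`signedVol_eq`). In polar coordinates the
integral of this density over the simplex is, up to a Gaussian moment, the integral of `exp (-q)`
over the positive orthant (`lintegral_orthant_exp_quad`). Gaussian integrals yield both properties
of the volume: * Boundedness: integrating out one variable and using the reversed Cauchy-Schwarz
inequality reduces dimension `n + 1` to dimension `n`, and triangles are reduced to one convergent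
double integral (`exists_bound_sqrt_det_mul_simplexMass`). * Cocycle identity: for `n + 2` points
the vertex determinants of the faces, with signs, form a constant vector field along which `q` does
not vary. Integrating the vanishing derivative of `exp (-q)` along it over the orthant leaves the
boundary terms, which are the volumes of the faces (`sum_signedVol_eq_zero`).

Algebra. A resolution with equivariant cone operators satisfies the fundamental lemma: two
equivariant bounded cochain maps that agree on augmentations agree on invariant cocycles of positive
degree up to coboundaries of invariant cochains (`ConeSystem.exists_coboundary_eq_sub`). Tuples have
such cones, and so do singular simplices of a contractible space. An equivariant map from `X` to `G`
(discontinuous in general) and iterated cones give maps in both directions that do not increase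
norms, so the canonical map is an isometric isomorphism (`exists_canonical_isometry`). Applied to
tuples of points of hyperbolic space, the lemma also identifies the cocycles obtained from an orbit
map and from `dev` (`IsCanonical.groupClass_eq_singularClass`).

Geometry. An isometry is determined by the germ of its composite with a chart, so germs of
developing maps form a covering of the contractible space `X`. A section is a developing map, unique
up to an isometry; uniqueness yields the holonomy and the independence of choices. -/

theorem BddFun.abs_apply_le (f : BddFun S) (s : S) : |f s| ≤ ‖f‖ :=
  lp.norm_apply_le_norm ENNReal.top_ne_zero f s

theorem BddFun.norm_le {f : BddFun S} {C : ℝ} (hC : 0 ≤ C) (h : ∀ s, |f s| ≤ C) : ‖f‖ ≤ C :=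
  lp.norm_le_of_forall_le hC h

theorem BddFun.ext {f g : BddFun S} (h : ∀ s, f s = g s) : f = g := lp.ext (funext h)

@[simp] theorem BddFun.add_apply (f g : BddFun S) (s : S) : (f + g) s = f s + g s := rfl
@[simp] theorem BddFun.sub_apply (f g : BddFun S) (s : S) : (f - g) s = f s - g s := rfl
@[simp] theorem BddFun.smul_apply (c : ℝ) (f : BddFun S) (s : S) : (c • f) s = c * f s := rfl
@[simp] theorem BddFun.zero_apply (s : S) : (0 : BddFun S) s = 0 := rfl

/-- A bounded function, from an explicit bound. -/
def BddFun.mk (f : S → ℝ) (C : ℝ) (h : ∀ s, |f s| ≤ C) : BddFun S :=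
  ⟨f, memℓp_infty_iff.mpr ⟨C, by rintro _ ⟨s, rfl⟩; exact h s⟩⟩

@[simp] theorem BddFun.mk_apply (f : S → ℝ) (C : ℝ) (h : ∀ s, |f s| ≤ C) (s : S) :
    BddFun.mk f C h s = f s := rfl

theorem norm_pullback_le (u : T → S) (f : BddFun S) : ‖pullback u f‖ ≤ ‖f‖ :=
  BddFun.norm_le (norm_nonneg f) fun t => f.abs_apply_le (u t)

/-- Composition with a map, as a continuous linear map. -/
def pullbackL (u : T → S) : BddFun S →L[ℝ] BddFun T :=
  (pullback u).mkContinuous 1 fun f => by simpa using norm_pullback_le u f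

@[simp] theorem pullbackL_apply (u : T → S) (f : BddFun S) : pullbackL u f = pullback u f := rfl

end BddFun

section Coboundary

variable {S : ℕ → Type*} (face : ∀ k, Fin (k + 2) → S (k + 1) → S k)

theorem coboundary_apply (k : ℕ) (f : BddFun (S k)) (s : S (k + 1)) :
    coboundary face k f s = ∑ i : Fin (k + 2), (-1 : ℝ) ^ (i : ℕ) * f (face k i s) := by
  have h : ∀ A : Finset (Fin (k + 2)),
      (∑ i ∈ A, (-1 : ℝ) ^ (i : ℕ) • pullback (face k i) : BddFun (S k) →ₗ[ℝ] BddFun (S (k + 1)))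
        f s = ∑ i ∈ A, (-1 : ℝ) ^ (i : ℕ) * f (face k i s) := by
    intro A
    induction A using Finset.cons_induction with
    | empty => simp
    | cons i A hi ih =>
      rw [Finset.sum_cons, Finset.sum_cons, ← ih]
      rfl
  exact h Finset.univ

/-- The coboundary operator as a continuous linear map. -/
def coboundaryL (k : ℕ) : BddFun (S k) →L[ℝ] BddFun (S (k + 1)) :=
  ∑ i : Fin (k + 2), (-1 : ℝ) ^ (i : ℕ) • pullbackL (face k i)

@[simp] theorem coboundaryL_apply (k : ℕ) (f : BddFun (S k)) :
    coboundaryL face k f = coboundary face k f := by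
  simp only [coboundaryL, coboundary, sum_apply, LinearMap.sum_apply]
  rfl

/-- The simplicial identities imply that the coboundary operator squares to zero. -/
theorem coboundary_coboundary
    (hface : ∀ (k : ℕ) (i j : Fin (k + 2)), i ≤ j → ∀ s : S (k + 2),
      face k i (face (k + 1) j.succ s) = face k j (face (k + 1) i.castSucc s))
    (k : ℕ) (f : BddFun (S k)) : coboundary face (k + 1) (coboundary face k f) = 0 := by
  refine BddFun.ext fun s => ?_
  obtain ⟨F, hF⟩ : ∃ F : S k → ℝ, ∀ s, f s = F s := ⟨f, fun _ => rfl⟩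
  simp only [coboundary_apply, BddFun.zero_apply, Finset.mul_sum, hF]
  rw [← Finset.sum_product' (Finset.univ : Finset (Fin (k + 3)))
    (Finset.univ : Finset (Fin (k + 2)))
    (fun j i => (-1 : ℝ) ^ (j : ℕ) * ((-1) ^ (i : ℕ) * F (face k i (face (k + 1) j s))))]
  rw [← Finset.sum_filter_add_sum_filter_not _ (fun x => x.2.castSucc < x.1),
    add_eq_zero_iff_eq_neg, ← Finset.sum_neg_distrib]
  -- The pair `(j, i)` with `i < j` cancels against the pair `(i, j - 1)`, whose sign is opposite.
  refine Finset.sum_bij'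
    (fun x hx => (x.2.castSucc, x.1.pred (Fin.ne_zero_of_lt (Finset.mem_filter.1 hx).2)))
    (fun x hx => (x.2.succ, x.1.castLT (by
      have := (Finset.mem_filter.1 hx).2
      rw [not_lt, Fin.le_def, Fin.val_castSucc] at this
      omega))) ?_ ?_ ?_ ?_ ?_
  · rintro ⟨j, i⟩ hx
    simp only [Finset.mem_filter, Finset.mem_product, Finset.mem_univ, and_self, true_and, Fin.lt_def, Fin.val_castSucc,
      Fin.val_pred, not_lt] at hx ⊢
    omega
  · rintro ⟨j, i⟩ hx
    simp only [Finset.mem_filter, Finset.mem_product, Finset.mem_univ, and_self, true_and, Fin.lt_def, Fin.val_castSucc,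
      Fin.val_succ, Fin.val_castLT, not_lt] at hx ⊢
    omega
  · rintro ⟨j, i⟩ hx
    simp
  · rintro ⟨j, i⟩ hx
    simp
  · rintro ⟨j, i⟩ hx
    have hx' := (Finset.mem_filter.1 hx).2
    have hj : j ≠ 0 := Fin.ne_zero_of_lt hx'
    obtain ⟨j, rfl⟩ := Fin.exists_succ_eq.2 hj
    have hij : i ≤ j := by
      simp only [Fin.lt_def, Fin.le_def, Fin.val_castSucc, Fin.val_succ] at hx' ⊢
      omega
    rw [hface k i j hij]
    simp only [Fin.val_succ, Fin.val_castSucc, Fin.pred_succ]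
    ring

end Coboundary

/-! ## The fundamental lemma of homological algebra for bounded cochains -/

section Fundamental

variable {S T : ℕ → Type*} {P G : Type*} [Group G] [MulAction G P]
  [∀ k, MulAction G (S k)] [∀ k, MulAction G (T k)]
  {faceS : ∀ k, Fin (k + 2) → S (k + 1) → S k} {faceT : ∀ k, Fin (k + 2) → T (k + 1) → T k}

variable (faceS) in
/-- An equivariant family of cone operators on a family of simplices. -/
structure ConeSystem (P G : Type*) [Group G] [MulAction G P] [∀ k, MulAction G (S k)] where
  cone : ∀ k, P → S k → S (k + 1)
  apex : P → S 0
  cone_smul : ∀ k (g : G) q s, cone k (g • q) (g • s) = g • cone k q s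
  face_zero : ∀ k q s, faceS k 0 (cone k q s) = s
  face_succ : ∀ k q (i : Fin (k + 2)) s,
    faceS (k + 1) i.succ (cone (k + 1) q s) = cone k q (faceS k i s)
  face_one : ∀ q s, faceS 0 1 (cone 0 q s) = apex q

variable (c : ConeSystem faceS P G) (b : ∀ k, T k → P)

/-- The face of a cone opposite to the apex returns `f`; each other face is the cone over a face,
with its sign reversed by the index shift. So coning is a contracting homotopy. -/
theorem ConeSystem.pullback_coboundary (k : ℕ) (q : P) (f : BddFun (S (k + 1))) :
    pullback (c.cone (k + 1) q) (coboundary faceS (k + 1) f) =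
      f - coboundary faceS k (pullback (c.cone k q) f) := by
  refine BddFun.ext fun s => ?_
  rw [pullback_apply, coboundary_apply, Fin.sum_univ_succ, BddFun.sub_apply, coboundary_apply,
    sub_eq_add_neg, ← Finset.sum_neg_distrib, c.face_zero]
  simp only [Fin.val_zero, pow_zero, one_mul, c.face_succ, Fin.val_succ, pow_succ, pullback_apply]
  simp

/-- In degree zero the second face is the apex, so the correction term is a constant function, which
is visible only to the augmentation. -/
theorem ConeSystem.pullback_coboundary_zero (q : P) (f : BddFun (S 0)) :
    pullback (c.cone 0 q) (coboundary faceS 0 f) =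
      f - pullback (fun _ => c.apex q) f := by
  refine BddFun.ext fun s => ?_
  rw [pullback_apply, coboundary_apply, Fin.sum_univ_two, c.face_zero, c.face_one]
  simp [sub_eq_add_neg]

theorem ConeSystem.abs_diag_le {k : ℕ} (w : BddFun (S k) →L[ℝ] BddFun (T k))
    (f : BddFun (S (k + 1))) (t : T k) :
    |w (pullback (c.cone k (b k t)) f) t| ≤ ‖w‖ * ‖f‖ :=
  (BddFun.abs_apply_le _ t).trans ((w.le_opNorm _).trans
    (mul_le_mul_of_nonneg_left (norm_pullback_le _ f) (norm_nonneg w)))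

/-- The operator `f ↦ (t ↦ w (f ∘ cone (b t)) t)`, as a linear map. -/
def ConeSystem.diagLinear {k : ℕ} (w : BddFun (S k) →L[ℝ] BddFun (T k)) :
    BddFun (S (k + 1)) →ₗ[ℝ] BddFun (T k) where
  toFun f := BddFun.mk (fun t => w (pullback (c.cone k (b k t)) f) t) (‖w‖ * ‖f‖)
    (c.abs_diag_le b w f)
  map_add' f g := BddFun.ext fun t => by
    rw [BddFun.mk_apply, map_add, map_add]
    rfl
  map_smul' a f := BddFun.ext fun t => by
    rw [BddFun.mk_apply, map_smul, map_smul]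
    rfl

/-- The operator `f ↦ (t ↦ w (f ∘ cone (b t)) t)`. -/
def ConeSystem.diag {k : ℕ} (w : BddFun (S k) →L[ℝ] BddFun (T k)) :
    BddFun (S (k + 1)) →L[ℝ] BddFun (T k) :=
  (c.diagLinear b w).mkContinuous ‖w‖ fun f => BddFun.norm_le
    (mul_nonneg (norm_nonneg w) (norm_nonneg f)) (c.abs_diag_le b w f)

theorem ConeSystem.diag_apply {k : ℕ} (w : BddFun (S k) →L[ℝ] BddFun (T k))
    (f : BddFun (S (k + 1))) (t : T k) :
    c.diag b w f t = w (pullback (c.cone k (b k t)) f) t := rfl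

/-- A single cone operator is not equivariant, but here the apex parameter `b k t` moves together
with `t`. -/
theorem ConeSystem.diag_equivariant (hb : ∀ k (g : G) t, b k (g • t) = g • b k t)
    {k : ℕ} (w : BddFun (S k) →L[ℝ] BddFun (T k))
    (hw : ∀ (g : G) f, w (pullback (fun s => g • s) f) = pullback (fun t => g • t) (w f))
    (g : G) (f : BddFun (S (k + 1))) :
    c.diag b w (pullback (fun s => g • s) f) = pullback (fun t => g • t) (c.diag b w f) := by
  refine BddFun.ext fun t => ?_
  rw [pullback_apply, diag_apply, diag_apply, hb]
  have : pullback (c.cone k (b k t)) (pullback (fun s => g • s) f) =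
      pullback (fun s => g • s) (pullback (c.cone k (g • b k t)) f) :=
    BddFun.ext fun s => by simp [c.cone_smul]
  rw [this, hw, pullback_apply]

/-- The difference between a cochain map and the part that is already known to be
null-homotopic. -/
def ConeSystem.remainder (c : ConeSystem faceS P G) (b : ∀ k, T k → P)
    (faceT : ∀ k, Fin (k + 2) → T (k + 1) → T k)
    (u : ∀ k, BddFun (S k) →L[ℝ] BddFun (T k)) : ∀ k, BddFun (S k) →L[ℝ] BddFun (T k)
  | 0 => u 0
  | k + 1 => u (k + 1) - (coboundaryL faceT k).comp (c.diag b (c.remainder b faceT u k))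

theorem ConeSystem.remainder_succ_apply (u : ∀ k, BddFun (S k) →L[ℝ] BddFun (T k)) (k : ℕ)
    (f : BddFun (S (k + 1))) :
    c.remainder b faceT u (k + 1) f =
      u (k + 1) f - coboundary faceT k (c.diag b (c.remainder b faceT u k) f) := by
  simp [remainder]

theorem coboundary_equivariant
    (hface : ∀ k i (g : G) t, faceT k i (g • t) = g • faceT k i t) (k : ℕ) (g : G)
    (f : BddFun (T k)) :
    coboundary faceT k (pullback (fun t => g • t) f) =
      pullback (fun t => g • t) (coboundary faceT k f) :=
  BddFun.ext fun t => by simp [coboundary_apply, hface]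

theorem ConeSystem.remainder_equivariant (hb : ∀ k (g : G) t, b k (g • t) = g • b k t)
    (hface : ∀ k i (g : G) t, faceT k i (g • t) = g • faceT k i t)
    (u : ∀ k, BddFun (S k) →L[ℝ] BddFun (T k))
    (hu : ∀ k (g : G) f, u k (pullback (fun s => g • s) f) = pullback (fun t => g • t) (u k f))
    (k : ℕ) : ∀ (g : G) (f : BddFun (S k)),
    c.remainder b faceT u k (pullback (fun s => g • s) f) =
      pullback (fun t => g • t) (c.remainder b faceT u k f) := by
  induction k with
  | zero => exact hu 0
  | succ k ih =>
    intro g f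
    rw [remainder_succ_apply, remainder_succ_apply, hu, map_sub,
      c.diag_equivariant b hb _ ih, coboundary_equivariant hface]

/-- Write `w` for the remainder and `h` for `diag` of it. The homotopy formula for cones gives `h (d
f) = w f` as soon as `w` kills coboundaries. By induction `w (d g) = u (d g) - d (h (d g)) = d (u g
- w g)`, and `u g - w g` is zero or itself a coboundary. In degree zero the correction is constant,
hence killed by `u 0`. -/
theorem ConeSystem.diag_remainder_coboundary
    (hdd : ∀ k (f : BddFun (T k)), coboundary faceT (k + 1) (coboundary faceT k f) = 0)
    (u : ∀ k, BddFun (S k) →L[ℝ] BddFun (T k))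
    (hcomm : ∀ k f, u (k + 1) (coboundary faceS k f) = coboundary faceT k (u k f))
    (haug : ∀ (a : ℝ) (f : BddFun (S 0)), (∀ s, f s = a) → u 0 f = 0)
    (k : ℕ) (f : BddFun (S k)) :
    c.diag b (c.remainder b faceT u k) (coboundary faceS k f) = c.remainder b faceT u k f := by
  induction k with
  | zero =>
    refine BddFun.ext fun t => ?_
    rw [diag_apply, c.pullback_coboundary_zero, map_sub]
    change (u 0 f - u 0 _) t = u 0 f t
    rw [haug _ _ (fun s => pullback_apply _ _ _), sub_zero]
  | succ k ih =>
    refine BddFun.ext fun t => ?_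
    rw [diag_apply, c.pullback_coboundary, map_sub]
    suffices h : ∀ g, c.remainder b faceT u (k + 1) (coboundary faceS k g) = 0 by rw [h, sub_zero]
    intro g
    rw [remainder_succ_apply, ih, hcomm, ← map_sub]
    cases k with
    | zero => simp [remainder]
    | succ k => rw [remainder_succ_apply, sub_sub_cancel, hdd]

/-- An equivariant bounded cochain map that vanishes on the augmentation maps the invariant
cocycles of positive degree to coboundaries of invariant cochains. -/
theorem ConeSystem.exists_coboundary_eq (c : ConeSystem faceS P G) (b : ∀ k, T k → P)
    (hb : ∀ k (g : G) t, b k (g • t) = g • b k t)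
    (hface : ∀ k i (g : G) t, faceT k i (g • t) = g • faceT k i t)
    (hdd : ∀ k (f : BddFun (T k)), coboundary faceT (k + 1) (coboundary faceT k f) = 0)
    (u : ∀ k, BddFun (S k) →L[ℝ] BddFun (T k))
    (hu : ∀ k (g : G) f, u k (pullback (fun s => g • s) f) = pullback (fun t => g • t) (u k f))
    (hcomm : ∀ k f, u (k + 1) (coboundary faceS k f) = coboundary faceT k (u k f))
    (haug : ∀ (a : ℝ) (f : BddFun (S 0)), (∀ s, f s = a) → u 0 f = 0)
    {k : ℕ} (f : BddFun (S (k + 1))) (hf : f ∈ invariants G (S (k + 1)))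
    (hd : coboundary faceS (k + 1) f = 0) :
    ∃ h ∈ invariants G (T k), coboundary faceT k h = u (k + 1) f := by
  refine ⟨c.diag b (c.remainder b faceT u k) f, fun g t => ?_, ?_⟩
  · have h := c.diag_equivariant b hb _ (c.remainder_equivariant b hb hface u hu k) g f
    have hfg : pullback (fun s => g • s) f = f := BddFun.ext fun s => hf g s
    rw [hfg] at h
    exact (congrArg (fun F : BddFun (T k) => F t) h).symm
  · have h := c.diag_remainder_coboundary b hdd u hcomm haug (k + 1) f
    rw [hd, map_zero, remainder_succ_apply] at h
    exact (sub_eq_zero.1 h.symm).symm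

end Fundamental

end HypVol

end

/-! ### Signed hyperbolic volume: uniform bound and cocycle identity. -/

noncomputable section

namespace HypVol

open MeasureTheory Set ENNReal

/-! ## Integrals over orthants -/

section Orthant

/-- The open positive orthant. -/
def orthant (k : ℕ) : Set (Fin k → ℝ) := {a | ∀ i, 0 < a i}

theorem measurableSet_orthant (k : ℕ) : MeasurableSet (orthant k) := by
  have : orthant k = ⋂ i, {a | 0 < a i} := by ext; simp [orthant]
  rw [this]
  exact MeasurableSet.iInter fun i => measurableSet_lt measurable_const (measurable_pi_apply i)

theorem measurableSet_coordSimplex (n : ℕ) : MeasurableSet (coordSimplex n) := by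
  have : coordSimplex n = (⋂ i, {s | 0 ≤ s i}) ∩ {s | ∑ i, s i ≤ 1} := by
    ext; simp [coordSimplex]
  rw [this]
  refine (MeasurableSet.iInter fun i =>
    measurableSet_le measurable_const (measurable_pi_apply i)).inter
    (measurableSet_le (by fun_prop) measurable_const)

theorem lintegral_insertNth {n : ℕ} (i : Fin (n + 1)) {f : (Fin (n + 1) → ℝ) → ℝ≥0∞}
    (hf : Measurable f) :
    ∫⁻ a, f a = ∫⁻ b : Fin n → ℝ, ∫⁻ t : ℝ, f (i.insertNth t b) := by
  refine (((volume_preserving_piFinSuccAbove (fun _ : Fin (n + 1) => ℝ) i).symm).lintegral_map_equiv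
    f _).trans ?_
  exact lintegral_prod_symm' _ (hf.comp (MeasurableEquiv.measurable _))

theorem lintegral_orthant_insertNth {n : ℕ} (i : Fin (n + 1)) {f : (Fin (n + 1) → ℝ) → ℝ≥0∞}
    (hf : Measurable f) :
    ∫⁻ a in orthant (n + 1), f a =
      ∫⁻ b in orthant n, ∫⁻ t in Ioi (0 : ℝ), f (i.insertNth t b) := by
  rw [← lintegral_indicator (measurableSet_orthant _),
    lintegral_insertNth i (hf.indicator (measurableSet_orthant _)),
    ← lintegral_indicator (measurableSet_orthant _)]
  refine lintegral_congr fun b => ?_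
  by_cases hb : b ∈ orthant n
  · rw [indicator_of_mem hb, ← lintegral_indicator measurableSet_Ioi]
    refine lintegral_congr fun t => ?_
    have : (i.insertNth t b : Fin (n + 1) → ℝ) ∈ orthant (n + 1) ↔ t ∈ Ioi (0 : ℝ) := by
      simp only [orthant, mem_ofPred_eq, i.forall_iff_succAbove, Fin.insertNth_apply_same,
        Fin.insertNth_apply_succAbove, mem_Ioi]
      exact and_iff_left hb
    simp only [indicator, this]
  · rw [indicator_of_notMem hb]
    refine (lintegral_congr fun t => indicator_of_notMem (fun h => hb fun j => ?_) _).trans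
      lintegral_zero
    simpa using h (i.succAbove j)

theorem orthant_ae_eq (k : ℕ) : (orthant k : Set (Fin k → ℝ)) =ᵐ[volume] {a | ∀ i, 0 ≤ a i} := by
  have h := Measure.univ_pi_Ioi_ae_eq_Ici (ι := Fin k) (α := fun _ => ℝ)
    (μ := fun _ => volume) (f := fun _ => 0)
  have h1 : (univ.pi fun _ : Fin k => Ioi (0 : ℝ)) = orthant k := by ext; simp [orthant, Set.mem_pi]
  have h2 : (Ici fun _ : Fin k => (0 : ℝ)) = {a | ∀ i, 0 ≤ a i} := by ext; simp [Pi.le_def]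
  rw [h1, h2] at h
  exact h

theorem lintegral_comp_smul {E : Type*} [NormedAddCommGroup E] [NormedSpace ℝ E]
    [MeasurableSpace E] [BorelSpace E] [FiniteDimensional ℝ E] (μ : Measure E)
    [μ.IsAddHaarMeasure] {g : E → ℝ≥0∞} (hg : Measurable g) {r : ℝ} (hr : 0 < r) :
    ∫⁻ x, g (r • x) ∂μ = ENNReal.ofReal ((r ^ Module.finrank ℝ E)⁻¹) * ∫⁻ x, g x ∂μ := by
  rw [← lintegral_map hg (measurable_const_smul r), Measure.map_addHaar_smul μ hr.ne',
    lintegral_smul_measure, abs_of_pos (by positivity), smul_eq_mul]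

theorem lintegral_Ioi_comp_mul {g : ℝ → ℝ≥0∞} (hg : Measurable g) {r : ℝ} (hr : 0 < r) :
    ∫⁻ t in Ioi (0 : ℝ), g (r * t) = ENNReal.ofReal r⁻¹ * ∫⁻ t in Ioi (0 : ℝ), g t := by
  have h := lintegral_comp_smul volume (hg.indicator measurableSet_Ioi (s := Ioi (0 : ℝ))) hr
  rw [lintegral_indicator measurableSet_Ioi, Module.finrank_self, pow_one] at h
  rw [← h, ← lintegral_indicator measurableSet_Ioi]
  refine lintegral_congr fun t => ?_
  simp only [indicator, mem_Ioi, smul_eq_mul, mul_pos_iff_of_pos_left hr]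

/-- The point of the standard simplex with the coordinates `s`. -/
def bary {n : ℕ} (s : Fin n → ℝ) : Fin (n + 1) → ℝ := Fin.cons (1 - ∑ i, s i) s

@[simp] theorem bary_zero {n : ℕ} (s : Fin n → ℝ) : bary s 0 = 1 - ∑ i, s i := rfl
@[simp] theorem bary_succ {n : ℕ} (s : Fin n → ℝ) (i : Fin n) : bary s i.succ = s i := rfl

theorem sum_bary {n : ℕ} (s : Fin n → ℝ) : ∑ i, bary s i = 1 := by
  simp [Fin.sum_univ_succ]

theorem bary_nonneg {n : ℕ} {s : Fin n → ℝ} (hs : s ∈ coordSimplex n) (i : Fin (n + 1)) :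
    0 ≤ bary s i := by
  refine Fin.cases ?_ (fun j => ?_) i
  · simpa using hs.2
  · simpa using hs.1 j

@[fun_prop] theorem continuous_bary {n : ℕ} : Continuous (bary : (Fin n → ℝ) → _) := by
  refine continuous_pi fun i => ?_
  refine Fin.cases ?_ (fun j => ?_) i <;> simp only [bary_zero, bary_succ] <;> fun_prop

/-- Integration over the orthant in simplicial polar coordinates. -/
theorem lintegral_orthant_polar {n : ℕ} {f : (Fin (n + 1) → ℝ) → ℝ≥0∞} (hf : Measurable f) :
    ∫⁻ a in orthant (n + 1), f a =
      ∫⁻ r in Ioi (0 : ℝ), ENNReal.ofReal (r ^ n) * ∫⁻ s in coordSimplex n, f (r • bary s) := by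
  classical
  set A : Set (ℝ × (Fin n → ℝ)) := {x | (∀ i, 0 ≤ x.2 i) ∧ ∑ i, x.2 i ≤ x.1}
  have hA : MeasurableSet A := by
    have : A = (⋂ i, {x | 0 ≤ x.2 i}) ∩ {x | ∑ i, x.2 i ≤ x.1} := by ext; simp [A]
    rw [this]
    exact (MeasurableSet.iInter fun i => measurableSet_le measurable_const (by fun_prop)).inter
      (measurableSet_le (by fun_prop) (by fun_prop))
  -- The coordinate `a 0` is replaced by the sum `r` of all coordinates, a shear of determinant one;
  -- afterwards the remaining coordinates are scaled by `r`.
  set F : ℝ × (Fin n → ℝ) → ℝ≥0∞ := A.indicator fun x => f (Fin.cons (x.1 - ∑ i, x.2 i) x.2)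
  have hF : Measurable F := by
    refine (hf.comp ?_).indicator hA
    refine measurable_pi_iff.2 fun i => ?_
    refine Fin.cases ?_ (fun j => ?_) i <;> simp only [Fin.cons_zero, Fin.cons_succ] <;> fun_prop
  calc ∫⁻ a in orthant (n + 1), f a
      = ∫⁻ b in {a : Fin n → ℝ | ∀ i, 0 ≤ a i}, ∫⁻ t in Ici (0 : ℝ), f (Fin.cons t b) := by
        rw [lintegral_orthant_insertNth 0 hf, Measure.restrict_congr_set (orthant_ae_eq n)]
        refine lintegral_congr fun b => ?_
        rw [Measure.restrict_congr_set Ioi_ae_eq_Ici]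
        simp only [Fin.insertNth_zero']
    _ = ∫⁻ b, ∫⁻ r, F (r, b) := by
        have hm : MeasurableSet {a : Fin n → ℝ | ∀ i, 0 ≤ a i} := by
          have : {a : Fin n → ℝ | ∀ i, 0 ≤ a i} = ⋂ i, {a | 0 ≤ a i} := by ext; simp
          rw [this]
          exact MeasurableSet.iInter fun i => measurableSet_le measurable_const (by fun_prop)
        rw [← lintegral_indicator hm]
        refine lintegral_congr fun b => ?_
        rw [← lintegral_add_right_eq_self (fun r => F (r, b)) (∑ i, b i)]
        by_cases hb : ∀ i, 0 ≤ b i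
        · rw [indicator_of_mem (by simpa using hb), ← lintegral_indicator measurableSet_Ici]
          refine lintegral_congr fun t => ?_
          have : (t + ∑ i, b i, b) ∈ A ↔ t ∈ Ici (0 : ℝ) := by simp [A, hb]
          simp only [F, indicator, this, add_sub_cancel_right]
        · rw [indicator_of_notMem (by simpa using hb)]
          exact ((lintegral_congr fun t => indicator_of_notMem (fun h => hb h.1) _).trans
            lintegral_zero).symm
    _ = ∫⁻ r, ∫⁻ b, F (r, b) := lintegral_lintegral_swap (by fun_prop)
    _ = _ := by
        rw [← lintegral_indicator measurableSet_Ioi]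
        refine lintegral_congr_ae ?_
        filter_upwards [compl_mem_ae_iff.2 (measure_singleton (0 : ℝ))] with r hr
        have hr : r ≠ 0 := hr
        rcases lt_or_gt_of_ne hr with h | h
        · rw [indicator_of_notMem (by simpa using h.le)]
          refine (lintegral_congr fun b => indicator_of_notMem (fun hb => ?_) _).trans
            lintegral_zero
          exact absurd (hb.2.trans_lt h) (Finset.sum_nonneg fun i _ => hb.1 i).not_gt
        · rw [indicator_of_mem (by simpa using h)]
          have hs := lintegral_comp_smul volume (g := fun b : Fin n → ℝ => F (r, b))
            (by fun_prop) h
          rw [Module.finrank_fin_fun] at hs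
          have : ∫⁻ s in coordSimplex n, f (r • bary s) = ∫⁻ s, F (r, r • s) := by
            rw [← lintegral_indicator (measurableSet_coordSimplex n)]
            refine lintegral_congr fun s => ?_
            have h1 : (r, r • s) ∈ A ↔ s ∈ coordSimplex n := by
              simp only [A, coordSimplex, mem_ofPred_eq, Pi.smul_apply, smul_eq_mul,
                mul_nonneg_iff_of_pos_left h, ← Finset.mul_sum, mul_le_iff_le_one_right h]
            have h2 : (Fin.cons (r - ∑ i, (r • s) i) (r • s) : Fin (n + 1) → ℝ) = r • bary s := by
              refine funext fun i => ?_
              refine Fin.cases ?_ (fun j => ?_) i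
              · simp [← Finset.mul_sum, mul_sub]
              · simp
            simp only [F, indicator, h1, h2]
          rw [this, hs, ← mul_assoc, ← ENNReal.ofReal_mul (by positivity),
            mul_inv_cancel₀ (by positivity), ENNReal.ofReal_one, one_mul]

end Orthant

/-! ## Quadratic forms on the orthant -/

section Quad

open Matrix

/-- The quadratic form of a matrix. -/
def quad {k : ℕ} (c : Matrix (Fin k) (Fin k) ℝ) (a : Fin k → ℝ) : ℝ := a ⬝ᵥ c *ᵥ a

theorem quad_smul {k : ℕ} (c : Matrix (Fin k) (Fin k) ℝ) (r : ℝ) (a : Fin k → ℝ) :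
    quad c (r • a) = r ^ 2 * quad c a := by
  simp [quad, mulVec_smul]; ring

@[fun_prop] theorem continuous_quad {k : ℕ} (c : Matrix (Fin k) (Fin k) ℝ) :
    Continuous (quad c) := by
  unfold quad; fun_prop

/-- The integral of `q ^ (-(n + 1) / 2)` over the standard simplex, for a quadratic form `q` on
`ℝ ^ (n + 1)`. -/
def simplexMass {n : ℕ} (c : Matrix (Fin (n + 1)) (Fin (n + 1)) ℝ) : ℝ≥0∞ :=
  ∫⁻ s in coordSimplex n, ENNReal.ofReal ((√(quad c (bary s)))⁻¹ ^ (n + 1))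

/-- By homogeneity, the substitution of `r / √q` for `r` on the ray through `bary s` extracts the
factor `q ^ (-(n + 1) / 2)` from a radial integral that no longer depends on the ray. -/
theorem lintegral_orthant_quad {n : ℕ} (c : Matrix (Fin (n + 1)) (Fin (n + 1)) ℝ)
    (hc : ∀ s ∈ coordSimplex n, 0 < quad c (bary s)) {F : ℝ → ℝ≥0∞} (hF : Measurable F) :
    ∫⁻ a in orthant (n + 1), F (quad c a) =
      simplexMass c * ∫⁻ r in Ioi (0 : ℝ), ENNReal.ofReal (r ^ n) * F (r ^ 2) := by
  rw [lintegral_orthant_polar (by fun_prop)]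
  simp_rw [quad_smul]
  have h1 : ∀ r : ℝ, ENNReal.ofReal (r ^ n) *
      ∫⁻ s in coordSimplex n, F (r ^ 2 * quad c (bary s)) =
      ∫⁻ s in coordSimplex n, ENNReal.ofReal (r ^ n) * F (r ^ 2 * quad c (bary s)) := fun r =>
    (lintegral_const_mul _ (by fun_prop)).symm
  simp_rw [h1]
  rw [lintegral_lintegral_swap (by fun_prop), simplexMass, ← lintegral_mul_const _ (by fun_prop)]
  refine setLIntegral_congr_fun (measurableSet_coordSimplex n) fun s hs => ?_
  have hq := Real.sqrt_pos.2 (hc s hs)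
  have h2 := lintegral_Ioi_comp_mul (g := fun r => ENNReal.ofReal (r ^ n) * F (r ^ 2))
    (by fun_prop) hq
  calc ∫⁻ r in Ioi (0 : ℝ), ENNReal.ofReal (r ^ n) * F (r ^ 2 * quad c (bary s))
      = ∫⁻ r in Ioi (0 : ℝ), ENNReal.ofReal ((√(quad c (bary s)))⁻¹ ^ n) *
          (ENNReal.ofReal ((√(quad c (bary s)) * r) ^ n) * F ((√(quad c (bary s)) * r) ^ 2)) := by
        refine lintegral_congr fun r => ?_
        rw [← mul_assoc, ← ENNReal.ofReal_mul (by positivity), ← mul_pow, inv_mul_cancel_left₀ hq.ne',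
          mul_pow, Real.sq_sqrt (hc s hs).le, mul_comm (r ^ 2)]
    _ = _ := by
        rw [lintegral_const_mul _ (by fun_prop), h2, ← mul_assoc,
          ← ENNReal.ofReal_mul (by positivity), ← pow_succ]

end Quad

/-! ## Lorentzian Gram matrices -/

section Lorentzian

open Matrix

/-- Symmetric matrices with positive entries whose quadratic form satisfies the reversed
Cauchy-Schwarz inequality, such as the Gram matrices of timelike vectors of one time cone. -/
structure IsLorentzian {k : ℕ} (c : Matrix (Fin k) (Fin k) ℝ) : Prop where
  symm : ∀ i j, c i j = c j i
  pos : ∀ i j, 0 < c i j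
  quad_mul_quad_le : ∀ a b, 0 < quad c a → quad c a * quad c b ≤ (a ⬝ᵥ c *ᵥ b) ^ 2

variable {k : ℕ}

theorem quad_eq_sum (c : Matrix (Fin k) (Fin k) ℝ) (a : Fin k → ℝ) :
    quad c a = ∑ i, ∑ j, a i * (c i j * a j) := by
  simp [quad, dotProduct, mulVec, Finset.mul_sum]

theorem quad_pos {c : Matrix (Fin k) (Fin k) ℝ} (hc : ∀ i j, 0 < c i j) {a : Fin k → ℝ}
    (ha : ∀ i, 0 ≤ a i) {i : Fin k} (hi : 0 < a i) : 0 < quad c a := by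
  rw [quad_eq_sum]
  have h : ∀ i j, 0 ≤ a i * (c i j * a j) := fun i j =>
    mul_nonneg (ha i) (mul_nonneg (hc i j).le (ha j))
  refine Finset.sum_pos' (fun i _ => Finset.sum_nonneg fun j _ => h i j) ⟨i, Finset.mem_univ i, ?_⟩
  exact Finset.sum_pos' (fun j _ => h i j) ⟨i, Finset.mem_univ i, by have := hc i i; positivity⟩

theorem quad_bary_pos {n : ℕ} {c : Matrix (Fin (n + 1)) (Fin (n + 1)) ℝ} (hc : ∀ i j, 0 < c i j)
    {s : Fin n → ℝ} (hs : s ∈ coordSimplex n) : 0 < quad c (bary s) := by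
  obtain ⟨i, hi⟩ : ∃ i, 0 < bary s i := by
    by_contra! h
    have := sum_bary s
    have h2 := Finset.sum_nonpos fun i (_ : i ∈ Finset.univ) => h i
    linarith
  exact quad_pos hc (bary_nonneg hs) hi

/-- The principal minor without the first index. -/
abbrev tailMinor (c : Matrix (Fin (k + 1)) (Fin (k + 1)) ℝ) : Matrix (Fin k) (Fin k) ℝ :=
  c.submatrix Fin.succ Fin.succ

/-- The remaining entries of the first row. -/
abbrev headRow (c : Matrix (Fin (k + 1)) (Fin (k + 1)) ℝ) : Fin k → ℝ := fun j => c 0 j.succ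

theorem mulVec_cons {c : Matrix (Fin (k + 1)) (Fin (k + 1)) ℝ} (hc : ∀ i j, c i j = c j i)
    (t : ℝ) (v : Fin k → ℝ) :
    c *ᵥ (Fin.cons t v : Fin (k + 1) → ℝ) =
      Fin.cons (t * c 0 0 + headRow c ⬝ᵥ v) (t • headRow c + tailMinor c *ᵥ v) := by
  refine funext fun i => ?_
  refine Fin.cases ?_ (fun j => ?_) i
  · simp [mulVec, dotProduct, Fin.sum_univ_succ, mul_comm]
  · simp [mulVec, dotProduct, Fin.sum_univ_succ, mul_comm, hc j.succ 0]

theorem cons_dotProduct_cons (t u : ℝ) (v w : Fin k → ℝ) :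
    (Fin.cons t v : Fin (k + 1) → ℝ) ⬝ᵥ (Fin.cons u w : Fin (k + 1) → ℝ) = t * u + v ⬝ᵥ w := by
  simp [dotProduct, Fin.sum_univ_succ]

theorem dotProduct_mulVec_cons {c : Matrix (Fin (k + 1)) (Fin (k + 1)) ℝ}
    (hc : ∀ i j, c i j = c j i) (t u : ℝ) (v w : Fin k → ℝ) :
    (Fin.cons t v : Fin (k + 1) → ℝ) ⬝ᵥ c *ᵥ (Fin.cons u w : Fin (k + 1) → ℝ) =
      t * (u * c 0 0 + headRow c ⬝ᵥ w) + (u * (headRow c ⬝ᵥ v) + v ⬝ᵥ tailMinor c *ᵥ w) := by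
  rw [mulVec_cons hc, cons_dotProduct_cons, dotProduct_add, dotProduct_smul, smul_eq_mul,
    dotProduct_comm v (headRow c)]

theorem quad_cons {c : Matrix (Fin (k + 1)) (Fin (k + 1)) ℝ} (hc : ∀ i j, c i j = c j i)
    (t : ℝ) (v : Fin k → ℝ) :
    quad c (Fin.cons t v) = t ^ 2 * c 0 0 + 2 * t * (headRow c ⬝ᵥ v) + quad (tailMinor c) v := by
  rw [quad, dotProduct_mulVec_cons hc, quad]
  ring

theorem IsLorentzian.minor {c : Matrix (Fin (k + 1)) (Fin (k + 1)) ℝ} (hc : IsLorentzian c) :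
    IsLorentzian (tailMinor c) where
  symm i j := hc.symm _ _
  pos i j := hc.pos _ _
  quad_mul_quad_le a b ha := by
    have h := hc.quad_mul_quad_le (Fin.cons 0 a) (Fin.cons 0 b)
    simp only [quad_cons hc.symm, dotProduct_mulVec_cons hc.symm] at h
    simpa using h (by simpa using ha)

/-- The Schur complement formula for the determinant. -/
theorem det_eq_schur {c : Matrix (Fin (k + 1)) (Fin (k + 1)) ℝ} (hc : ∀ i j, c i j = c j i)
    {v : Fin k → ℝ} (hv : tailMinor c *ᵥ v = headRow c) :
    c.det = (c 0 0 - headRow c ⬝ᵥ v) * (tailMinor c).det := by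
  -- Row operations with coefficients `-v` clear the first row except for its first entry.
  have h := det_updateRow_sum c 0 (Fin.cons 1 (-v) : Fin (k + 1) → ℝ)
  rw [Fin.cons_zero, one_smul] at h
  have hrow : ∑ i, (Fin.cons 1 (-v) : Fin (k + 1) → ℝ) i • c i =
      Fin.cons (c 0 0 - headRow c ⬝ᵥ v) (0 : Fin k → ℝ) := by
    have := mulVec_cons hc 1 (-v)
    rw [mulVec_neg, hv, dotProduct_neg] at this
    rw [one_mul, one_smul, add_neg_cancel, ← sub_eq_add_neg] at this
    rw [← this]
    refine funext fun j => ?_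
    simp only [Finset.sum_apply, Pi.smul_apply, smul_eq_mul, mulVec, dotProduct]
    exact Finset.sum_congr rfl fun i _ => by rw [mul_comm, hc]
  rw [← h, hrow, det_succ_row_zero, Fin.sum_univ_succ]
  simp only [updateRow_self, Fin.cons_zero, Fin.cons_succ, Pi.zero_apply, mul_zero, zero_mul,
    Finset.sum_const_zero, add_zero, Fin.val_zero, pow_zero, one_mul]
  congr 2

/-- A kernel vector `v` of the minor must be orthogonal to the first row, and then `(0, v)` lies in
the kernel of `c`. Otherwise the reversed Cauchy-Schwarz inequality for `(0, w)` and `(t, v)` fails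
for small `t`, where the term linear in `t` dominates. -/
theorem IsLorentzian.det_eq_zero {c : Matrix (Fin (k + 1)) (Fin (k + 1)) ℝ} (hc : IsLorentzian c)
    {w : Fin k → ℝ} (hw : 0 < quad (tailMinor c) w) (h0 : (tailMinor c).det = 0) :
    c.det = 0 := by
  obtain ⟨v, hv, hcv⟩ := exists_mulVec_eq_zero_iff.2 h0
  suffices hβ : headRow c ⬝ᵥ v = 0 by
    refine exists_mulVec_eq_zero_iff.1 ⟨Fin.cons 0 v, fun h => hv ?_, ?_⟩
    · exact funext fun i => by simpa using congrFun h i.succ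
    · rw [mulVec_cons hc.symm, hβ, hcv]
      refine funext fun i => ?_
      refine Fin.cases ?_ (fun j => ?_) i <;> simp
  by_contra hβ
  set β := headRow c ⬝ᵥ v
  set q := quad (tailMinor c) w
  set y := headRow c ⬝ᵥ w
  have key : ∀ t : ℝ, q * (t ^ 2 * c 0 0 + 2 * t * β) ≤ (t * y) ^ 2 := by
    intro t
    have h := hc.quad_mul_quad_le (Fin.cons 0 w) (Fin.cons t v)
    have hq : quad (tailMinor c) v = 0 := by rw [quad, hcv, dotProduct_zero]
    rw [quad_cons hc.symm, quad_cons hc.symm, dotProduct_mulVec_cons hc.symm, hcv, hq] at h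
    simpa [q, y, β] using h (by simpa using hw)
  have hβ2 : 0 < β ^ 2 := by positivity
  have hy : 0 < y ^ 2 + 1 := by positivity
  -- This `t` satisfies `t ^ 2 * y ^ 2 ≤ q * t * β`, only half of the linear term on the left.
  have h1 := key (q / (y ^ 2 + 1) * β)
  have h2 : q * (q / (y ^ 2 + 1) * 2) * β ^ 2 ≤ (q / (y ^ 2 + 1)) ^ 2 * y ^ 2 * β ^ 2 := by
    have : 0 ≤ q * ((q / (y ^ 2 + 1) * β) ^ 2 * c 0 0) := by
      have := hc.pos 0 0
      positivity
    nlinarith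
  have h3 := le_of_mul_le_mul_right h2 hβ2
  have h4 : (q / (y ^ 2 + 1)) ^ 2 * y ^ 2 ≤ (q / (y ^ 2 + 1)) * q := by
    have h5 : q / (y ^ 2 + 1) * y ^ 2 ≤ q := by
      rw [div_mul_eq_mul_div, div_le_iff₀ hy]
      nlinarith
    rw [sq, mul_assoc]
    exact mul_le_mul_of_nonneg_left h5 (by positivity)
  have : 0 < q * (q / (y ^ 2 + 1)) := by positivity
  linarith

/-- If the minor is invertible and maps `v` to the first row, the Schur complement is `c 0 0 -
headRow c ⬝ᵥ v`. The vector `(1, -v)` is orthogonal to `(0, w)`, so the complement is nonpositive;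
its absolute value is at most `headRow c ⬝ᵥ v`, which the reversed Cauchy-Schwarz inequality in the
minor bounds. -/
theorem IsLorentzian.det_mul_quad_le {c : Matrix (Fin (k + 1)) (Fin (k + 1)) ℝ}
    (hc : IsLorentzian c) {w : Fin k → ℝ} (hw : 0 < quad (tailMinor c) w) :
    |c.det| * quad (tailMinor c) w ≤
      |(tailMinor c).det| * (headRow c ⬝ᵥ w) ^ 2 := by
  by_cases h0 : (tailMinor c).det = 0
  · rw [hc.det_eq_zero hw h0, h0]
    simp
  set v := (tailMinor c)⁻¹ *ᵥ headRow c
  have hv : tailMinor c *ᵥ v = headRow c := by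
    rw [mulVec_mulVec, mul_nonsing_inv _ (isUnit_iff_ne_zero.2 h0), one_mulVec]
  have hqv : quad (tailMinor c) v = headRow c ⬝ᵥ v := by rw [quad, hv, dotProduct_comm]
  have h1 : c 0 0 - headRow c ⬝ᵥ v ≤ 0 := by
    have h := hc.quad_mul_quad_le (Fin.cons 0 w) (Fin.cons 1 (-v))
    have hqn : quad (tailMinor c) (-v) = headRow c ⬝ᵥ v := by
      rw [← neg_one_smul ℝ v, quad_smul, hqv]; norm_num
    rw [quad_cons hc.symm, quad_cons hc.symm, dotProduct_mulVec_cons hc.symm, mulVec_neg, hv,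
      hqn] at h
    have h2 := h (by simpa using hw)
    have h3 : quad (tailMinor c) w * (c 0 0 - headRow c ⬝ᵥ v) ≤ 0 := by
      have e1 : w ⬝ᵥ headRow c = headRow c ⬝ᵥ w := dotProduct_comm _ _
      simp only [dotProduct_neg, e1] at h2
      linarith
    exact nonpos_of_mul_nonpos_right h3 hw
  have h2 := hc.minor.quad_mul_quad_le w v hw
  rw [hv, hqv, dotProduct_comm w (headRow c)] at h2
  rw [det_eq_schur hc.symm hv, abs_mul, abs_of_nonpos h1, mul_comm, ← mul_assoc, mul_comm]
  refine mul_le_mul_of_nonneg_left (le_trans ?_ h2) (abs_nonneg _)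
  have := hc.pos 0 0
  exact mul_le_mul_of_nonneg_left (by linarith) hw.le

end Lorentzian

/-! ## The uniform bound for the volume of hyperbolic simplices -/

section Bound

open Matrix

theorem lintegral_exp_neg_mul_Ioi {B : ℝ} (hB : 0 < B) :
    ∫⁻ t in Ioi (0 : ℝ), ENNReal.ofReal (Real.exp (-(B * t))) = ENNReal.ofReal (1 / B) := by
  have h1 : IntegrableOn (fun t => Real.exp (-B * t)) (Ioi 0) :=
    integrableOn_exp_mul_Ioi (neg_neg_iff_pos.2 hB) 0
  have h2 := integral_exp_mul_Ioi (neg_neg_iff_pos.2 hB) 0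
  simp_rw [← neg_mul]
  rw [← ofReal_integral_eq_lintegral_ofReal h1 (ae_of_all _ fun t => (Real.exp_pos _).le), h2]
  simp

theorem headRow_dotProduct_pos {k : ℕ} {c : Matrix (Fin (k + 2)) (Fin (k + 2)) ℝ}
    (hc : IsLorentzian c) {w : Fin (k + 1) → ℝ} (hw : w ∈ orthant (k + 1)) :
    0 < headRow c ⬝ᵥ w :=
  Finset.sum_pos (fun i _ => mul_pos (hc.pos _ _) (hw i)) Finset.univ_nonempty

/-- Omitting the term `t ^ 2 * c 0 0` in the exponent leaves an elementary exponential integral in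
`t`. -/
theorem lintegral_orthant_exp_le {k : ℕ} {c : Matrix (Fin (k + 2)) (Fin (k + 2)) ℝ}
    (hc : IsLorentzian c) :
    ∫⁻ a in orthant (k + 2), ENNReal.ofReal (Real.exp (-quad c a)) ≤
      ∫⁻ w in orthant (k + 1),
        ENNReal.ofReal (Real.exp (-quad (tailMinor c) w) / (2 * (headRow c ⬝ᵥ w))) := by
  rw [lintegral_orthant_insertNth 0 (by fun_prop)]
  refine setLIntegral_mono' (measurableSet_orthant _) fun w hw => ?_
  have hB := headRow_dotProduct_pos hc hw
  calc ∫⁻ t in Ioi (0 : ℝ), ENNReal.ofReal (Real.exp (-quad c (Fin.insertNth 0 t w)))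
      ≤ ∫⁻ t in Ioi (0 : ℝ), ENNReal.ofReal (Real.exp (-quad (tailMinor c) w)) *
          ENNReal.ofReal (Real.exp (-(2 * (headRow c ⬝ᵥ w) * t))) := by
        refine setLIntegral_mono' measurableSet_Ioi fun t ht => ?_
        rw [← ENNReal.ofReal_mul (Real.exp_pos _).le, ← Real.exp_add, Fin.insertNth_zero',
          quad_cons hc.symm]
        refine ENNReal.ofReal_le_ofReal (Real.exp_le_exp.2 ?_)
        have := mul_nonneg (sq_nonneg t) (hc.pos 0 0).le
        linarith
    _ = _ := by
        rw [lintegral_const_mul _ (by fun_prop), lintegral_exp_neg_mul_Ioi (by positivity),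
          ← ENNReal.ofReal_mul (Real.exp_pos _).le, mul_one_div]

/-- The radial integral `∫ r ^ n * exp (-r ^ 2)`. -/
def gaussMoment (n : ℕ) : ℝ≥0∞ :=
  ∫⁻ r in Ioi (0 : ℝ), ENNReal.ofReal (r ^ n) * ENNReal.ofReal (Real.exp (-r ^ 2))

theorem gaussMoment_ne_top (n : ℕ) : gaussMoment n ≠ ⊤ := by
  have h := integrableOn_rpow_mul_exp_neg_mul_sq (b := 1) one_pos (s := n) (by
    have : (0 : ℝ) ≤ n := n.cast_nonneg
    linarith)
  refine ne_of_lt (lt_of_eq_of_lt ?_ h.lintegral_lt_top)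
  refine setLIntegral_congr_fun measurableSet_Ioi fun r hr => ?_
  have hr : 0 < r := hr
  rw [← ENNReal.ofReal_mul (by positivity), Real.rpow_natCast, neg_one_mul]

theorem gaussMoment_ne_zero (n : ℕ) : gaussMoment n ≠ 0 := by
  refine ne_of_gt ((setLIntegral_pos_iff (by fun_prop)).2 ?_)
  refine lt_of_lt_of_le (by simp : 0 < volume (Ioi (0 : ℝ))) (measure_mono fun r hr => ?_)
  have hr : 0 < r := hr
  refine ⟨?_, hr⟩
  rw [Function.mem_support, ← ENNReal.ofReal_mul (by positivity)]
  exact (ENNReal.ofReal_pos.2 (by positivity)).ne'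

theorem lintegral_orthant_exp_quad {n : ℕ} {c : Matrix (Fin (n + 1)) (Fin (n + 1)) ℝ}
    (hc : ∀ i j, 0 < c i j) :
    ∫⁻ a in orthant (n + 1), ENNReal.ofReal (Real.exp (-quad c a)) =
      simplexMass c * gaussMoment n :=
  lintegral_orthant_quad c (fun _ hs => quad_bary_pos hc hs)
    (F := fun u => ENNReal.ofReal (Real.exp (-u))) (by fun_prop)

/-- The inductive step of the volume bound: `IsLorentzian.det_mul_quad_le` trades the linear form in
the denominator for the square root of the minor's quadratic form. The new integrand again depends
only on that form, so the polar formula applies. -/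
theorem sqrt_det_mul_lintegral_le_of_minor {n : ℕ} (hn : 1 ≤ n)
    {c : Matrix (Fin (n + 2)) (Fin (n + 2)) ℝ} (hc : IsLorentzian c) :
    ENNReal.ofReal √|c.det| * (simplexMass c * gaussMoment (n + 1)) ≤
      ENNReal.ofReal √|(tailMinor c).det| * simplexMass (tailMinor c) * gaussMoment (n - 1) := by
  have hc' := hc.minor
  have hmeas : Measurable fun u : ℝ => ENNReal.ofReal (Real.exp (-u) / (2 * √u)) := by fun_prop
  calc ENNReal.ofReal √|c.det| * (simplexMass c * gaussMoment (n + 1))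
      ≤ ENNReal.ofReal √|c.det| * ∫⁻ w in orthant (n + 1),
          ENNReal.ofReal (Real.exp (-quad (tailMinor c) w) / (2 * (headRow c ⬝ᵥ w))) := by
        rw [← lintegral_orthant_exp_quad hc.pos]
        exact mul_le_mul_right (lintegral_orthant_exp_le hc) _
    _ ≤ ENNReal.ofReal √|(tailMinor c).det| * ∫⁻ w in orthant (n + 1),
          ENNReal.ofReal (Real.exp (-quad (tailMinor c) w) / (2 * √(quad (tailMinor c) w))) := by
        rw [← lintegral_const_mul _ (by simp only [dotProduct]; fun_prop),
          ← lintegral_const_mul _ (by fun_prop)]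
        refine setLIntegral_mono' (measurableSet_orthant _) fun w hw => ?_
        rw [← ENNReal.ofReal_mul (Real.sqrt_nonneg _), ← ENNReal.ofReal_mul (Real.sqrt_nonneg _)]
        refine ENNReal.ofReal_le_ofReal ?_
        have hB := headRow_dotProduct_pos hc hw
        have hq : 0 < quad (tailMinor c) w := quad_pos hc'.pos (fun i => (hw i).le) (hw 0)
        have hs := Real.sqrt_pos.2 hq
        have h := Real.sqrt_le_sqrt (hc.det_mul_quad_le hq)
        rw [Real.sqrt_mul (abs_nonneg _), Real.sqrt_mul (abs_nonneg _), Real.sqrt_sq hB.le] at h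
        rw [← mul_div_assoc, ← mul_div_assoc, div_le_div_iff₀ (by positivity) (by positivity)]
        have := Real.exp_pos (-quad (tailMinor c) w)
        nlinarith [mul_le_mul_of_nonneg_left h this.le]
    _ ≤ _ := by
        rw [lintegral_orthant_quad (tailMinor c) (fun _ hs => quad_bary_pos hc'.pos hs) hmeas,
          mul_assoc]
        refine mul_le_mul_right (mul_le_mul_right ?_ _) _
        refine setLIntegral_mono' measurableSet_Ioi fun r hr => ?_
        have hr : 0 < r := hr
        rw [← ENNReal.ofReal_mul (by positivity), ← ENNReal.ofReal_mul (by positivity)]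
        refine ENNReal.ofReal_le_ofReal ?_
        -- The division by `r` lowers the moment by one, which needs `1 ≤ n`.
        obtain ⟨m, rfl⟩ := Nat.exists_eq_add_of_le' hn
        rw [Real.sqrt_sq hr.le, Nat.add_sub_cancel, pow_succ, ← mul_div_assoc,
          div_le_iff₀ (by positivity)]
        have := Real.exp_pos (-r ^ 2)
        have h2 : 0 < r ^ m * r * Real.exp (-r ^ 2) := by positivity
        linarith

/-- The integral over the quadrant that bounds the area of hyperbolic triangles. -/
def quadrantIntegral : ℝ≥0∞ :=
  ∫⁻ s in Ioi (0 : ℝ), ∫⁻ t in Ioi (0 : ℝ), ENNReal.ofReal (Real.exp (-(t * s)) / (t + s))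

/-- The estimate for large `s`, from `t + s ≥ s`. -/
theorem lintegral_quadrant_inner_le_inv_sq {s : ℝ} (hs : 0 < s) :
    ∫⁻ t in Ioi (0 : ℝ), ENNReal.ofReal (Real.exp (-(t * s)) / (t + s)) ≤
      ENNReal.ofReal (s ^ (-2 : ℝ)) := by
  calc ∫⁻ t in Ioi (0 : ℝ), ENNReal.ofReal (Real.exp (-(t * s)) / (t + s))
      ≤ ∫⁻ t in Ioi (0 : ℝ), ENNReal.ofReal (1 / s) * ENNReal.ofReal (Real.exp (-(s * t))) := by
        refine setLIntegral_mono' measurableSet_Ioi fun t ht => ?_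
        have ht : 0 < t := ht
        rw [← ENNReal.ofReal_mul (by positivity), mul_comm s t, one_div_mul_eq_div]
        exact ENNReal.ofReal_le_ofReal
          (div_le_div_of_nonneg_left (Real.exp_pos _).le hs (by linarith))
    _ = _ := by
        rw [lintegral_const_mul _ (by fun_prop), lintegral_exp_neg_mul_Ioi hs,
          ← ENNReal.ofReal_mul (by positivity), Real.rpow_neg hs.le, Real.rpow_two]
        congr 1
        field_simp

/-- The estimate near `s = 0`: the weighted inequality `s ^ (1/4) * t ^ (3/4) ≤ t + s` leaves
singularities in `t` and in `s` that are both integrable. -/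
theorem lintegral_quadrant_inner_le_inv_sqrt {s : ℝ} (hs : 0 < s) :
    ∫⁻ t in Ioi (0 : ℝ), ENNReal.ofReal (Real.exp (-(t * s)) / (t + s)) ≤
      ENNReal.ofReal (Real.Gamma (1 / 4) * s ^ (-(1 / 2) : ℝ)) := by
  have hG := Real.integral_rpow_mul_exp_neg_mul_Ioi (a := 1 / 4) (r := s) (by norm_num) hs
  have hpos : 0 < Real.Gamma (1 / 4) := Real.Gamma_pos_of_pos (by norm_num)
  have hI : IntegrableOn (fun t : ℝ => t ^ ((1 / 4 : ℝ) - 1) * Real.exp (-(s * t))) (Ioi 0) :=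
    .of_integral_ne_zero (by rw [hG]; positivity)
  calc ∫⁻ t in Ioi (0 : ℝ), ENNReal.ofReal (Real.exp (-(t * s)) / (t + s))
      ≤ ∫⁻ t in Ioi (0 : ℝ), ENNReal.ofReal (s ^ (-(1 / 4) : ℝ)) *
          ENNReal.ofReal (t ^ ((1 / 4 : ℝ) - 1) * Real.exp (-(s * t))) := by
        refine setLIntegral_mono' measurableSet_Ioi fun t ht => ?_
        have ht : 0 < t := ht
        rw [← ENNReal.ofReal_mul (by positivity), mul_comm s t, ← mul_assoc]
        refine ENNReal.ofReal_le_ofReal ?_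
        have h := Real.geom_mean_le_arith_mean2_weighted (w₁ := 1 / 4) (w₂ := 3 / 4) (p₁ := s)
          (p₂ := t) (by norm_num) (by norm_num) hs.le ht.le (by norm_num)
        have h1 : s ^ (1 / 4 : ℝ) * t ^ (3 / 4 : ℝ) ≤ t + s := by linarith
        have h2 : s ^ (-(1 / 4) : ℝ) * t ^ ((1 / 4 : ℝ) - 1) =
            (s ^ (1 / 4 : ℝ) * t ^ (3 / 4 : ℝ))⁻¹ := by
          rw [mul_inv, ← Real.rpow_neg hs.le, ← Real.rpow_neg ht.le]
          norm_num
        rw [h2, div_eq_inv_mul]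
        exact mul_le_mul_of_nonneg_right (inv_anti₀ (by positivity) h1) (Real.exp_pos _).le
    _ = _ := by
        rw [lintegral_const_mul' _ _ ENNReal.ofReal_ne_top,
          ← ofReal_integral_eq_lintegral_ofReal hI ?_, hG, ← ENNReal.ofReal_mul (by positivity)]
        · congr 1
          rw [one_div s, Real.inv_rpow hs.le, ← Real.rpow_neg hs.le, ← mul_assoc,
            ← Real.rpow_add hs]
          norm_num
          ring
        · filter_upwards [ae_restrict_mem measurableSet_Ioi] with t ht
          have ht : 0 < t := ht
          simp only [Pi.zero_apply]
          positivity

theorem quadrantIntegral_ne_top : quadrantIntegral ≠ ⊤ := by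
  rw [quadrantIntegral, ← Ioc_union_Ioi_eq_Ioi (zero_le_one (α := ℝ)),
    lintegral_union measurableSet_Ioi (Ioc_disjoint_Ioi le_rfl)]
  rw [Ioc_union_Ioi_eq_Ioi (zero_le_one (α := ℝ))]
  refine ENNReal.add_ne_top.2 ⟨ne_of_lt (lt_of_le_of_lt (setLIntegral_mono' measurableSet_Ioc
    fun s hs => lintegral_quadrant_inner_le_inv_sqrt hs.1) ?_),
    ne_of_lt (lt_of_le_of_lt (setLIntegral_mono' measurableSet_Ioi
    fun s hs => lintegral_quadrant_inner_le_inv_sq (one_pos.trans hs)) ?_)⟩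
  · have h : IntervalIntegrable (fun s : ℝ => s ^ (-(1 / 2) : ℝ)) volume 0 1 :=
      intervalIntegral.intervalIntegrable_rpow' (by norm_num)
    rw [intervalIntegrable_iff_integrableOn_Ioc_of_le zero_le_one] at h
    exact (h.const_mul _).lintegral_lt_top
  · exact (integrableOn_Ioi_rpow_of_lt (by norm_num) one_pos).lintegral_lt_top

theorem lintegral_orthant_two {f : (Fin 2 → ℝ) → ℝ≥0∞} (hf : Measurable f) :
    ∫⁻ a in orthant 2, f a = ∫⁻ s in Ioi (0 : ℝ), ∫⁻ t in Ioi (0 : ℝ), f ![t, s] := by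
  have hcons : Measurable fun x : (Fin 1 → ℝ) × ℝ => f (Fin.insertNth 0 x.2 x.1) := by
    refine hf.comp (measurable_pi_iff.2 fun i => ?_)
    refine Fin.cases ?_ (fun j => ?_) i
    · simp only [Fin.insertNth_zero', Fin.cons_zero]; fun_prop
    · simp only [Fin.insertNth_zero', Fin.cons_succ]; fun_prop
  rw [lintegral_orthant_insertNth 0 hf, lintegral_orthant_insertNth 0
    (Measurable.lintegral_prod_right' (ν := volume.restrict (Ioi 0)) hcons)]
  have h0 : orthant 0 = univ := eq_univ_of_forall fun _ i => i.elim0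
  rw [h0, Measure.restrict_univ, Measure.volume_pi_eq_dirac, lintegral_dirac]
  simp only [Fin.insertNth_zero']
  refine lintegral_congr fun s => lintegral_congr fun t => congrArg f ?_
  refine funext fun i => ?_
  fin_cases i <;> rfl

/-- Dropping the diagonal terms leaves an integral that depends on the three off-diagonal entries
only. Rescaling the two variables removes them, and the bound `2 * x * y * z` for the determinant is
just what compensates the Jacobian. -/
theorem sqrt_det_mul_lintegral_le_of_three {c : Matrix (Fin 3) (Fin 3) ℝ} (hc : IsLorentzian c) :
    ENNReal.ofReal √|c.det| * (simplexMass c * gaussMoment 2) ≤ quadrantIntegral := by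
  have hx := hc.pos 0 1
  have hy := hc.pos 0 2
  have hz := hc.pos 1 2
  set x := c 0 1
  set y := c 0 2
  set z := c 1 2
  have hB : ∀ t s : ℝ, headRow c ⬝ᵥ ![t, s] = x * t + y * s := fun t s => by
    simp [headRow, dotProduct, Fin.sum_univ_two, x, y]
  have hQ : ∀ t s : ℝ, quad (tailMinor c) ![t, s] = c 1 1 * t ^ 2 + 2 * z * t * s +
      c 2 2 * s ^ 2 := fun t s => by
    have h21 : c 2 1 = z := hc.symm 2 1
    have h12 : c 1 2 = z := rfl
    simp [quad_eq_sum, Fin.sum_univ_two, h21, h12]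
    ring
  have hQ2 : ∀ t s : ℝ, 2 * z * t * s ≤ quad (tailMinor c) ![t, s] := fun t s => by
    have h1 := mul_nonneg (hc.pos 1 1).le (sq_nonneg t)
    have h2 := mul_nonneg (hc.pos 2 2).le (sq_nonneg s)
    rw [hQ]
    linarith
  have hdet : |c.det| ≤ 2 * x * y * z := by
    -- With this `w` both terms of `headRow c ⬝ᵥ w` equal one.
    have h := hc.det_mul_quad_le (w := ![x⁻¹, y⁻¹])
      (lt_of_lt_of_le (by positivity) (hQ2 x⁻¹ y⁻¹))
    have h1 : |(tailMinor c).det| ≤ z ^ 2 := by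
      have h21 : c 2 1 = z := hc.symm 2 1
      have h12 : c 1 2 = z := rfl
      have h2 := hc.minor.quad_mul_quad_le ![1, 0] ![0, 1] (by rw [hQ]; simpa using hc.pos 1 1)
      have h3 : tailMinor c 0 1 = z := rfl
      simp [hQ, dotProduct, mulVec, Fin.sum_univ_two, h12] at h2
      rw [det_fin_two]
      simp only [submatrix_apply, Fin.succ_zero_eq_one, Fin.succ_one_eq_two, h21, h12]
      have h4 := mul_pos (hc.pos 1 1) (hc.pos 2 2)
      rw [abs_of_nonpos (by linarith)]
      linarith
    rw [hB, mul_inv_cancel₀ hx.ne', mul_inv_cancel₀ hy.ne'] at h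
    have h2 : |c.det| * (2 * z * x⁻¹ * y⁻¹) ≤ z ^ 2 * (1 + 1) ^ 2 :=
      (mul_le_mul_of_nonneg_left (hQ2 _ _) (abs_nonneg _)).trans
        (h.trans (mul_le_mul_of_nonneg_right h1 (by norm_num)))
    have h3 : |c.det| * (2 * z * x⁻¹ * y⁻¹) = 2 * |c.det| * z / (x * y) := by field_simp
    rw [h3, div_le_iff₀ (by positivity)] at h2
    nlinarith
  -- The scales solve `lam * mu = 2 * z`, `kap * lam = x`, `kap * mu = y`: the exponent becomes a
  -- product and the denominator a sum of the new variables.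
  set lam := √(2 * z * x / y)
  set mu := √(2 * z * y / x)
  set kap := √(x * y / (2 * z))
  have hlam : 0 < lam := Real.sqrt_pos.2 (by positivity)
  have hmu : 0 < mu := Real.sqrt_pos.2 (by positivity)
  have hkap : 0 < kap := Real.sqrt_pos.2 (by positivity)
  have hlm : lam * mu = 2 * z := by
    rw [← Real.sqrt_mul (by positivity), show 2 * z * x / y * (2 * z * y / x) = (2 * z) ^ 2 by
      field_simp, Real.sqrt_sq (by positivity)]
  have hkl : kap * lam = x := by
    rw [← Real.sqrt_mul (by positivity), show x * y / (2 * z) * (2 * z * x / y) = x ^ 2 by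
      field_simp, Real.sqrt_sq hx.le]
  have hkm : kap * mu = y := by
    rw [← Real.sqrt_mul (by positivity), show x * y / (2 * z) * (2 * z * y / x) = y ^ 2 by
      field_simp, Real.sqrt_sq hy.le]
  have hd2 : √|c.det| ≤ 2 * z * kap := by
    refine Real.sqrt_le_iff.2 ⟨by positivity, hdet.trans (le_of_eq ?_)⟩
    rw [mul_pow, Real.sq_sqrt (by positivity)]
    field_simp
  set g : ℝ → ℝ → ℝ≥0∞ := fun s t => ENNReal.ofReal (Real.exp (-(t * s)) / (t + s))
  have hg : Measurable (Function.uncurry g) := by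
    simp only [g, Function.uncurry_def]
    fun_prop
  have hg1 : ∀ s, Measurable (g s) := fun s => by simp only [g]; fun_prop
  have hg2 : Measurable fun s => ∫⁻ t in Ioi (0 : ℝ), g s t :=
    Measurable.lintegral_prod_right' (ν := volume.restrict (Ioi 0)) hg
  calc ENNReal.ofReal √|c.det| * (simplexMass c * gaussMoment 2)
      ≤ ENNReal.ofReal (2 * z * kap) * ∫⁻ w in orthant 2,
          ENNReal.ofReal (Real.exp (-quad (tailMinor c) w) / (2 * (headRow c ⬝ᵥ w))) := by
        rw [← lintegral_orthant_exp_quad hc.pos]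
        exact mul_le_mul' (ENNReal.ofReal_le_ofReal hd2) (lintegral_orthant_exp_le hc)
    _ ≤ ENNReal.ofReal (2 * z * kap) * ∫⁻ s in Ioi (0 : ℝ), ∫⁻ t in Ioi (0 : ℝ),
          ENNReal.ofReal kap⁻¹ * g (mu * s) (lam * t) := by
        rw [lintegral_orthant_two (by simp only [dotProduct]; fun_prop)]
        refine mul_le_mul_right (setLIntegral_mono' measurableSet_Ioi fun s hs =>
          setLIntegral_mono' measurableSet_Ioi fun t ht => ?_) _
        have hs : 0 < s := hs
        have ht : 0 < t := ht
        rw [← ENNReal.ofReal_mul (by positivity), hB]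
        refine ENNReal.ofReal_le_ofReal ?_
        have h1 : lam * t * (mu * s) = 2 * z * t * s := by rw [← hlm]; ring
        have h2 : x * t + y * s = kap * (lam * t + mu * s) := by rw [← hkl, ← hkm]; ring
        have h3 : 0 < lam * t + mu * s := by positivity
        rw [h1, h2, inv_mul_eq_div, div_div, mul_comm (lam * t + mu * s)]
        refine div_le_div₀ (Real.exp_pos _).le (Real.exp_le_exp.2 (neg_le_neg (hQ2 t s)))
          (by positivity) ?_
        have := mul_pos hkap h3
        linarith
    _ = ENNReal.ofReal (2 * z * kap) * (ENNReal.ofReal kap⁻¹ * (ENNReal.ofReal lam⁻¹ *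
          (ENNReal.ofReal mu⁻¹ * quadrantIntegral))) := by
        congr 1
        have h1 : ∀ s : ℝ, ∫⁻ t in Ioi (0 : ℝ), ENNReal.ofReal kap⁻¹ * g (mu * s) (lam * t) =
            ENNReal.ofReal kap⁻¹ * (ENNReal.ofReal lam⁻¹ *
              ∫⁻ t in Ioi (0 : ℝ), g (mu * s) t) := fun s => by
          rw [lintegral_const_mul' _ _ ENNReal.ofReal_ne_top,
            lintegral_Ioi_comp_mul (hg1 _) hlam]
        simp_rw [h1]
        rw [lintegral_const_mul' _ _ ENNReal.ofReal_ne_top,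
          lintegral_const_mul' _ _ ENNReal.ofReal_ne_top,
          lintegral_Ioi_comp_mul (g := fun s => ∫⁻ t in Ioi (0 : ℝ), g s t) hg2 hmu]
        rfl
    _ = quadrantIntegral := by
        rw [← mul_assoc, ← mul_assoc, ← mul_assoc, ← ENNReal.ofReal_mul (by positivity),
          ← ENNReal.ofReal_mul (by positivity), ← ENNReal.ofReal_mul (by positivity), ← hlm]
        have : lam * mu * kap * kap⁻¹ * lam⁻¹ * mu⁻¹ = 1 := by field_simp
        rw [this, ENNReal.ofReal_one, one_mul]

/-- Hyperbolic simplices of a fixed dimension `n ≥ 2` have uniformly bounded volume. -/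
theorem exists_bound_sqrt_det_mul_simplexMass {n : ℕ} (hn : 2 ≤ n) :
    ∃ C : ℝ≥0∞, C ≠ ⊤ ∧ ∀ c : Matrix (Fin (n + 1)) (Fin (n + 1)) ℝ, IsLorentzian c →
      ENNReal.ofReal √|c.det| * simplexMass c ≤ C := by
  -- The induction starts with triangles, since geodesic segments have unbounded length.
  induction n, hn using Nat.le_induction with
  | base =>
    refine ⟨quadrantIntegral / gaussMoment 2,
      ENNReal.div_ne_top quadrantIntegral_ne_top (gaussMoment_ne_zero 2), fun c hc => ?_⟩
    rw [ENNReal.le_div_iff_mul_le (.inl (gaussMoment_ne_zero 2)) (.inl (gaussMoment_ne_top 2)),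
      mul_assoc]
    exact sqrt_det_mul_lintegral_le_of_three hc
  | succ n hn ih =>
    obtain ⟨C, hC, h⟩ := ih
    refine ⟨C * gaussMoment (n - 1) / gaussMoment (n + 1),
      ENNReal.div_ne_top (ENNReal.mul_ne_top hC (gaussMoment_ne_top _)) (gaussMoment_ne_zero _),
      fun c hc => ?_⟩
    rw [ENNReal.le_div_iff_mul_le (.inl (gaussMoment_ne_zero _)) (.inl (gaussMoment_ne_top _)),
      mul_assoc]
    exact (sqrt_det_mul_lintegral_le_of_minor (by omega) hc).trans
      (mul_le_mul_left (h _ hc.minor) _)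

end Bound

/-! ## The Lorentz form -/

section Lorentz

open Matrix

variable {n : ℕ}

/-- The Lorentz form as a bilinear map. -/
def lorentzB (n : ℕ) : (Fin (n + 1) → ℝ) →ₗ[ℝ] (Fin (n + 1) → ℝ) →ₗ[ℝ] ℝ :=
  LinearMap.mk₂ ℝ lorentz
    (fun x y z => by simp [lorentz, add_mul, Finset.sum_add_distrib]; ring)
    (fun c x y => by simp [lorentz, mul_assoc, Finset.mul_sum, mul_sub])
    (fun x y z => by simp [lorentz, mul_add, Finset.sum_add_distrib]; ring)
    (fun c x y => by simp [lorentz, Finset.mul_sum, mul_sub, mul_left_comm])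

@[simp] theorem lorentzB_apply (x y : Fin (n + 1) → ℝ) : lorentzB n x y = lorentz x y := rfl

theorem lorentz_comm (x y : Fin (n + 1) → ℝ) : lorentz x y = lorentz y x := by
  simp [lorentz, mul_comm]

/-- The diagonal matrix of the Lorentz form. -/
def lorentzMatrix (n : ℕ) : Matrix (Fin (n + 1)) (Fin (n + 1)) ℝ :=
  diagonal (Fin.cons 1 fun _ => -1)

theorem lorentz_eq_dotProduct (x y : Fin (n + 1) → ℝ) :
    lorentz x y = x ⬝ᵥ lorentzMatrix n *ᵥ y := by
  simp [lorentz, lorentzMatrix, dotProduct, mulVec_diagonal, Fin.sum_univ_succ, sub_eq_add_neg]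

theorem abs_det_lorentzMatrix : |(lorentzMatrix n).det| = 1 := by
  simp [lorentzMatrix, det_diagonal, Fin.prod_univ_succ, abs_pow]

/-- The combination `b 0 • a - a 0 • b` has no time component, so the form is nonpositive on it.
Expanding and completing the square gives the inequality. -/
theorem lorentz_mul_le_sq {a : Fin (n + 1) → ℝ} (ha : 0 < lorentz a a) (b : Fin (n + 1) → ℝ) :
    lorentz a a * lorentz b b ≤ lorentz a b ^ 2 := by
  have ha0 : 0 < a 0 ^ 2 := by
    have h : 0 ≤ ∑ i : Fin n, a i.succ * a i.succ := Finset.sum_nonneg fun i _ => mul_self_nonneg _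
    rw [lorentz] at ha
    nlinarith
  have hu : lorentz (b 0 • a - a 0 • b) (b 0 • a - a 0 • b) ≤ 0 := by
    have h : 0 ≤ ∑ i : Fin n, (b 0 • a - a 0 • b) i.succ * (b 0 • a - a 0 • b) i.succ :=
      Finset.sum_nonneg fun i _ => mul_self_nonneg _
    have h0 : (b 0 • a - a 0 • b) 0 = 0 := by simp [mul_comm]
    rw [lorentz, h0]
    linarith
  have he : lorentz (b 0 • a - a 0 • b) (b 0 • a - a 0 • b) =
      b 0 ^ 2 * lorentz a a - 2 * (a 0 * b 0) * lorentz a b + a 0 ^ 2 * lorentz b b := by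
    rw [← lorentzB_apply]
    simp only [map_sub, map_smul, LinearMap.sub_apply, LinearMap.smul_apply, lorentzB_apply,
      smul_eq_mul, lorentz_comm b a]
    ring
  rw [he] at hu
  have h1 : a 0 ^ 2 * (lorentz a a * lorentz b b) ≤ a 0 ^ 2 * lorentz a b ^ 2 := by
    nlinarith [mul_le_mul_of_nonneg_left hu ha.le,
      sq_nonneg (b 0 * lorentz a a - a 0 * lorentz a b)]
  exact le_of_mul_le_mul_left h1 ha0

theorem one_le_lorentz (x y : Hyp n) : 1 ≤ lorentz x.1 y.1 := by
  obtain ⟨x, hx, hx0⟩ := x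
  obtain ⟨y, hy, hy0⟩ := y
  simp only [lorentz] at hx hy ⊢
  have hcs := Finset.sum_mul_sq_le_sq_mul_sq Finset.univ (fun i : Fin n => x i.succ)
    (fun i => y i.succ)
  simp only [sq] at hcs
  have ha : 0 ≤ ∑ i : Fin n, x i.succ * x i.succ := Finset.sum_nonneg fun i _ => mul_self_nonneg _
  have hb : 0 ≤ ∑ i : Fin n, y i.succ * y i.succ := Finset.sum_nonneg fun i _ => mul_self_nonneg _
  set A := ∑ i : Fin n, x i.succ * x i.succ
  set B := ∑ i : Fin n, y i.succ * y i.succ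
  set S := ∑ i : Fin n, x i.succ * y i.succ
  have hx1 : 1 ≤ x 0 := by nlinarith
  have hy1 : 1 ≤ y 0 := by nlinarith
  have h1 : 1 ≤ x 0 * y 0 := by nlinarith
  have h2 : S * S ≤ (x 0 * y 0 - 1) * (x 0 * y 0 - 1) := by
    have hA : A = x 0 * x 0 - 1 := by linarith
    have hB : B = y 0 * y 0 - 1 := by linarith
    rw [hA, hB] at hcs
    nlinarith [sq_nonneg (x 0 - y 0)]
  have h3 : |S| ≤ x 0 * y 0 - 1 := abs_le_of_sq_le_sq (by nlinarith) (by linarith)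
  linarith [le_abs_self S]

/-- The Gram matrix of points of hyperbolic space. -/
def gram {k : ℕ} (x : Fin k → Hyp n) : Matrix (Fin k) (Fin k) ℝ :=
  of fun i j => lorentz (x i).1 (x j).1

theorem dotProduct_gram {k : ℕ} (x : Fin k → Hyp n) (a b : Fin k → ℝ) :
    a ⬝ᵥ gram x *ᵥ b = lorentz (∑ i, a i • (x i).1) (∑ i, b i • (x i).1) := by
  rw [← lorentzB_apply]
  simp only [map_sum, map_smul, LinearMap.sum_apply, LinearMap.smul_apply, lorentzB_apply,
    smul_eq_mul, dotProduct, mulVec, gram, of_apply, Finset.mul_sum]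
  rw [Finset.sum_comm]
  exact Finset.sum_congr rfl fun i _ => Finset.sum_congr rfl fun j _ => by ring

theorem quad_gram {k : ℕ} (x : Fin k → Hyp n) (a : Fin k → ℝ) :
    quad (gram x) a = lorentz (∑ i, a i • (x i).1) (∑ i, a i • (x i).1) := dotProduct_gram x a a

theorem gram_pos {k : ℕ} (x : Fin k → Hyp n) (i j : Fin k) : 0 < gram x i j :=
  one_pos.trans_le (one_le_lorentz _ _)

theorem isLorentzian_gram {k : ℕ} (x : Fin k → Hyp n) : IsLorentzian (gram x) where
  symm i j := lorentz_comm _ _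
  pos := gram_pos x
  quad_mul_quad_le a b ha := by
    rw [dotProduct_gram, quad_gram, quad_gram]
    rw [quad_gram] at ha
    exact lorentz_mul_le_sq ha _

theorem sq_sum_le_quad_gram {k : ℕ} (x : Fin k → Hyp n) {a : Fin k → ℝ} (ha : ∀ i, 0 ≤ a i) :
    (∑ i, a i) ^ 2 ≤ quad (gram x) a := by
  rw [quad_eq_sum, sq, Finset.sum_mul_sum]
  refine Finset.sum_le_sum fun i _ => Finset.sum_le_sum fun j _ =>
    mul_le_mul_of_nonneg_left ?_ (ha i)
  exact le_mul_of_one_le_left (ha j) (one_le_lorentz _ _)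

/-- The determinant of `n + 1` points of the hyperboloid. -/
def vertexDet (x : Fin (n + 1) → Hyp n) : ℝ := (of fun i => (x i).1).det

/-- The Gram matrix is `A * J * Aᵀ`, with the vertices as the rows of `A` and `J` of determinant
`±1`. -/
theorem abs_det_gram (x : Fin (n + 1) → Hyp n) : √|(gram x).det| = |vertexDet x| := by
  have h : gram x = (of fun i => (x i).1) * lorentzMatrix n * (of fun i => (x i).1)ᵀ := by
    refine Matrix.ext fun i j => ?_
    simp only [gram, of_apply, lorentz_eq_dotProduct, Matrix.mul_assoc]
    rfl
  rw [h, det_mul, det_mul, det_transpose, abs_mul, abs_mul, abs_det_lorentzMatrix, mul_one,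
    ← vertexDet, Real.sqrt_mul_self (abs_nonneg _)]

end Lorentz

/-! ## Signed volumes of geodesic simplices -/

section SignedVol

open Matrix

variable {n : ℕ}

/-- The radial projection commutes with linear maps that preserve the form, and the volume form is a
determinant, unchanged by maps of determinant one. -/
theorem signedVol_smul (g : IsoPlus n) (x : Fin (n + 1) → Hyp n) :
    signedVol (fun i => g • x i) = signedVol x := by
  have hsum : ∀ t : Fin (n + 1) → ℝ, ∑ i, t i • (g • x i).1 = g.1 (∑ i, t i • (x i).1) :=
    fun t => by simp only [map_sum, map_smul]; rfl
  have hparam : geodesicParam (fun i => g • x i) =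
      fun s => g.1.toContinuousLinearEquiv (geodesicParam x s) := by
    refine funext fun s => ?_
    simp only [geodesicParam, geodesicSimplex, hsum, g.2.1]
    exact (map_smul g.1 _ _).symm
  have hdet : ∀ y v, volForm (g.1 y) (fun i => g.1 (v i)) = volForm y v := by
    intro y v
    have h : (of (Fin.cons (g.1 y) fun i => g.1 (v i)) : Matrix (Fin (n + 1)) (Fin (n + 1)) ℝ) =
        of (Fin.cons y v : Fin (n + 1) → Fin (n + 1) → ℝ) * (LinearMap.toMatrix' g.1.toLinearMap)ᵀ
        := by
      refine Matrix.ext fun i j => ?_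
      have key : ∀ w, g.1 w j = (w ᵥ* (LinearMap.toMatrix' g.1.toLinearMap)ᵀ) j := fun w => by
        rw [vecMul_transpose, LinearMap.toMatrix'_mulVec]; rfl
      refine Fin.cases ?_ (fun i => ?_) i
      · exact key y
      · exact key (v i)
    have hd : LinearMap.det g.1.toLinearMap = 1 := by
      rw [← LinearEquiv.coe_det, g.2.2.2]; rfl
    rw [volForm, volForm, h, det_mul, det_transpose, LinearMap.det_toMatrix', hd, mul_one]
  simp only [signedVol, hparam]
  congr 1
  refine funext fun s => ?_
  have hf := g.1.toContinuousLinearEquiv.comp_fderiv (f := geodesicParam x) (x := s)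
  rw [show (fun s => g.1.toContinuousLinearEquiv (geodesicParam x s)) =
    g.1.toContinuousLinearEquiv ∘ geodesicParam x from rfl, hf]
  exact hdet _ _

/-- The parametrization is `φ • P` with `P` affine. Row operations remove the derivative of `φ`,
then move `P s` to the first vertex, and finally turn the edge vectors into vertices; each of the `n
+ 1` rows contributes one factor `φ`. -/
theorem volForm_geodesicParam (x : Fin (n + 1) → Hyp n) {s : Fin n → ℝ} (hs : s ∈ coordSimplex n) :
    volForm (geodesicParam x s) (fun i => fderiv ℝ (geodesicParam x) s (Pi.single i 1)) =
      vertexDet x * (√(quad (gram x) (bary s)))⁻¹ ^ (n + 1) := by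
  set P : (Fin n → ℝ) → Fin (n + 1) → ℝ := fun s => ∑ i, bary s i • (x i).1
  set v : Fin n → Fin (n + 1) → ℝ := fun i => (x i.succ).1 - (x 0).1
  set φ : (Fin n → ℝ) → ℝ := fun s => (√(quad (gram x) (bary s)))⁻¹
  have hPeq : ∀ s, P s = (x 0).1 + ∑ i, s i • v i := fun s => by
    simp only [P, Fin.sum_univ_succ, bary_zero, bary_succ, v, smul_sub, Finset.sum_sub_distrib,
      sub_smul, one_smul, ← Finset.sum_smul]
    abel
  have hparam : geodesicParam x = fun s => φ s • P s := by
    refine funext fun s => ?_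
    simp only [φ, quad_gram]
    rfl
  have hP : HasFDerivAt P (∑ i, (ContinuousLinearMap.proj i : (Fin n → ℝ) →L[ℝ] ℝ).smulRight (v i))
      s := by
    have h1 : P = fun s => (x 0).1 + (∑ i, (ContinuousLinearMap.proj i :
        (Fin n → ℝ) →L[ℝ] ℝ).smulRight (v i)) s := by
      refine funext fun s => ?_
      rw [hPeq]
      simp
    rw [h1]
    exact (ContinuousLinearMap.hasFDerivAt _).const_add _
  have hq := quad_bary_pos (gram_pos x) hs
  have hdP : DifferentiableAt ℝ P s := hP.differentiableAt
  have hφ : DifferentiableAt ℝ φ s := by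
    refine DifferentiableAt.inv (DifferentiableAt.sqrt ?_ hq.ne') (Real.sqrt_pos.2 hq).ne'
    have : (fun s => quad (gram x) (bary s)) = fun s => lorentz (P s) (P s) :=
      funext fun s => quad_gram x _
    rw [this]
    unfold lorentz
    have hc := differentiableAt_pi.1 hdP
    exact ((hc 0).mul (hc 0)).sub (DifferentiableAt.fun_sum fun i _ => (hc i.succ).mul (hc i.succ))
  have hder : ∀ i, fderiv ℝ (geodesicParam x) s (Pi.single i 1) =
      φ s • v i + fderiv ℝ φ s (Pi.single i 1) • P s := fun i => by
    rw [hparam, fderiv_fun_smul hφ hdP, hP.fderiv]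
    simp [Pi.single_apply, ite_smul]
  have hφ0 : φ s ≠ 0 := inv_ne_zero (Real.sqrt_pos.2 hq).ne'
  have hstep1 : volForm (geodesicParam x s)
      (fun i => fderiv ℝ (geodesicParam x) s (Pi.single i 1)) =
      (φ s • of (Fin.cons (P s) v : Fin (n + 1) → Fin (n + 1) → ℝ)).det := by
    refine det_eq_of_forall_row_eq_smul_add_const
      (Fin.cons 0 fun i => (φ s)⁻¹ * fderiv ℝ φ s (Pi.single i 1)) 0 rfl fun i j => ?_
    refine Fin.cases ?_ (fun i => ?_) i
    · simp [hparam]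
    · simp only [of_apply, Fin.cons_succ, hder, Fin.cons_zero, Matrix.smul_apply, Pi.add_apply,
        Pi.smul_apply, smul_eq_mul]
      field_simp
  have hstep2 : (of (Fin.cons (P s) v : Fin (n + 1) → Fin (n + 1) → ℝ)).det =
      (of (Fin.cons (x 0).1 v : Fin (n + 1) → Fin (n + 1) → ℝ)).det := by
    have h := det_updateRow_sum (of (Fin.cons (x 0).1 v : Fin (n + 1) → Fin (n + 1) → ℝ)) 0
      (Fin.cons 1 s)
    rw [Fin.cons_zero, one_smul] at h
    rw [← h]
    congr 1
    refine Matrix.ext fun i j => ?_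
    refine Fin.cases ?_ (fun i => ?_) i
    · rw [updateRow_self, hPeq]
      simp [Fin.sum_univ_succ]
    · rw [updateRow_ne (Fin.succ_ne_zero i)]
      rfl
  have hstep3 : (of (Fin.cons (x 0).1 v : Fin (n + 1) → Fin (n + 1) → ℝ)).det = vertexDet x := by
    refine (det_eq_of_forall_row_eq_smul_add_const (Fin.cons 0 fun _ => 1) 0 rfl
      fun i j => ?_).symm
    refine Fin.cases ?_ (fun i => ?_) i <;> simp [v]
  rw [hstep1, det_smul, hstep2, hstep3, Fintype.card_fin, mul_comm]

/-- Gram entries are at least one, so the quadratic form is at least one on the standard simplex and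
the integrand at most one on a set of finite measure. -/
theorem simplexMass_gram_ne_top (x : Fin (n + 1) → Hyp n) : simplexMass (gram x) ≠ ⊤ := by
  have hvol : volume (coordSimplex n) < ⊤ := by
    refine lt_of_le_of_lt (measure_mono fun s hs => ?_)
      (isCompact_Icc (a := (0 : Fin n → ℝ)) (b := 1)).measure_lt_top
    refine ⟨fun i => hs.1 i, fun i => ?_⟩
    exact (Finset.single_le_sum (fun j _ => hs.1 j) (Finset.mem_univ i)).trans hs.2
  refine ne_of_lt (lt_of_le_of_lt (setLIntegral_mono' (measurableSet_coordSimplex n)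
    (g := fun _ => 1) fun s hs => ?_) ?_)
  · refine ENNReal.ofReal_le_one.2 (pow_le_one₀ (by positivity) (inv_le_one_of_one_le₀ ?_))
    have h := sq_sum_le_quad_gram x (bary_nonneg hs)
    rw [sum_bary, one_pow] at h
    exact Real.one_le_sqrt.2 h
  · simpa using hvol

theorem signedVol_eq (x : Fin (n + 1) → Hyp n) :
    signedVol x = vertexDet x * (simplexMass (gram x)).toReal := by
  rw [signedVol, setIntegral_congr_fun (measurableSet_coordSimplex n)
    fun s hs => volForm_geodesicParam x hs, integral_const_mul, simplexMass,
    integral_eq_lintegral_of_nonneg_ae (ae_of_all _ fun s => by positivity)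
      (Measurable.aestronglyMeasurable (by fun_prop))]

/-- The signed volumes of geodesic simplices are bounded. -/
theorem exists_bound_signedVol (hn : 2 ≤ n) :
    ∃ C : ℝ, ∀ x : Fin (n + 1) → Hyp n, |signedVol x| ≤ C := by
  obtain ⟨C, hC, h⟩ := exists_bound_sqrt_det_mul_simplexMass hn
  refine ⟨C.toReal, fun x => ?_⟩
  have h1 := ENNReal.toReal_mono hC (h (gram x) (isLorentzian_gram x))
  rw [ENNReal.toReal_mul, ENNReal.toReal_ofReal (Real.sqrt_nonneg _), abs_det_gram] at h1
  rwa [signedVol_eq, abs_mul, abs_of_nonneg ENNReal.toReal_nonneg]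

/-- The linear relation between `n + 2` vectors in a space of dimension `n + 1`. -/
theorem sum_vertexDet_smul (x : Fin (n + 2) → Hyp n) :
    ∑ i : Fin (n + 2), ((-1 : ℝ) ^ (i : ℕ) * vertexDet fun j => x (i.succAbove j)) • (x i).1 = 0 := by
  refine funext fun m => ?_
  -- Prepending a copy of the coordinate `m` gives a square matrix with two equal columns; its
  -- expansion along the copy is coordinate `m` of the relation.
  have h : (of fun i : Fin (n + 2) => (Fin.cons ((x i).1 m) (x i).1 : Fin (n + 2) → ℝ)).det = 0 :=
    det_zero_of_column_eq (Fin.succ_ne_zero m).symm fun i => by simp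
  rw [det_succ_column_zero] at h
  rw [Finset.sum_apply, Pi.zero_apply]
  refine Eq.trans ?_ h
  refine Finset.sum_congr rfl fun i _ => ?_
  simp only [Pi.smul_apply, smul_eq_mul, of_apply, Fin.cons_zero]
  rw [mul_right_comm]
  rfl

theorem quad_gram_insertNth {k : ℕ} (x : Fin (k + 1) → Hyp n) (i : Fin (k + 1)) (t : ℝ)
    (a : Fin k → ℝ) :
    quad (gram x) (i.insertNth t a) = t ^ 2 +
      2 * t * lorentz (x i).1 (∑ j, a j • (x (i.succAbove j)).1) +
      quad (gram fun j => x (i.succAbove j)) a := by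
  rw [quad_gram, quad_gram, Fin.sum_univ_succAbove _ i]
  simp only [Fin.insertNth_apply_same, Fin.insertNth_apply_succAbove]
  rw [← lorentzB_apply, ← lorentzB_apply, ← lorentzB_apply]
  simp only [map_add, LinearMap.add_apply, map_smul, LinearMap.smul_apply, smul_eq_mul]
  simp only [lorentzB_apply, (x i).2.1, lorentz_comm _ (x i).1]
  ring

/-- The integrand is the derivative of `-exp (-(t ^ 2 + 2 * t * B + Q))`, so only the boundary value
at zero survives. -/
theorem lintegral_deriv_exp_neg_sq (B Q : ℝ) (hB : 0 ≤ B) :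
    ∫⁻ t in Ioi (0 : ℝ), ENNReal.ofReal (2 * (t + B) * Real.exp (-(t ^ 2 + 2 * t * B + Q))) =
      ENNReal.ofReal (Real.exp (-Q)) := by
  have hd : ∀ t ∈ Ici (0 : ℝ), HasDerivAt (fun t => -Real.exp (-(t ^ 2 + 2 * t * B + Q)))
      (2 * (t + B) * Real.exp (-(t ^ 2 + 2 * t * B + Q))) t := fun t _ => by
    have h1 : HasDerivAt (fun t : ℝ => -(t ^ 2 + 2 * t * B + Q)) (-(2 * t + 2 * B)) t := by
      have h2 := (((hasDerivAt_id t).pow 2).add (((hasDerivAt_id t).const_mul 2).mul_const B)).add_const Q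
      convert! h2.neg using 1
      simp
    convert! h1.exp.neg using 1
    ring
  have hpos : ∀ t ∈ Ioi (0 : ℝ), 0 ≤ 2 * (t + B) * Real.exp (-(t ^ 2 + 2 * t * B + Q)) :=
    fun t ht => by
      have ht : 0 < t := ht
      positivity
  have hlim : Filter.Tendsto (fun t => -Real.exp (-(t ^ 2 + 2 * t * B + Q))) Filter.atTop
      (𝓝 0) := by
    rw [← neg_zero]
    refine (Real.tendsto_exp_atBot.comp (Filter.tendsto_neg_atTop_atBot.comp ?_)).neg
    refine Filter.tendsto_atTop_add_const_right _ _ ?_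
    refine Filter.tendsto_atTop_mono' _ ?_ (Filter.tendsto_pow_atTop (α := ℝ) two_ne_zero)
    filter_upwards [Filter.eventually_ge_atTop 0] with t ht
    have : 0 ≤ 2 * t * B := by positivity
    linarith
  have hint := integrableOn_Ioi_deriv_of_nonneg' hd hpos hlim
  rw [← ofReal_integral_eq_lintegral_ofReal hint
    ((ae_restrict_iff' measurableSet_Ioi).2 (ae_of_all _ hpos)),
    integral_Ioi_of_hasDerivAt_of_nonneg' hd hpos hlim]
  simp

/-- The integrand is minus the `i`-th partial derivative of `exp (-q)`. Integrating the `i`-th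
variable leaves the Gaussian integral of the face opposite to the vertex `i`. -/
theorem lintegral_orthant_partial {k : ℕ} (x : Fin (k + 1) → Hyp n) (i : Fin (k + 1)) :
    ∫⁻ a in orthant (k + 1), ENNReal.ofReal (2 * lorentz (x i).1 (∑ j, a j • (x j).1) *
      Real.exp (-quad (gram x) a)) =
    ∫⁻ a in orthant k, ENNReal.ofReal (Real.exp (-quad (gram fun j => x (i.succAbove j)) a)) := by
  rw [lintegral_orthant_insertNth i (by unfold lorentz; fun_prop)]
  refine setLIntegral_congr_fun (measurableSet_orthant k) fun a ha => ?_
  set B := lorentz (x i).1 (∑ j, a j • (x (i.succAbove j)).1)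
  have hB : 0 ≤ B := by
    simp only [B]
    rw [← lorentzB_apply, map_sum]
    refine Finset.sum_nonneg fun j _ => ?_
    rw [map_smul, smul_eq_mul, lorentzB_apply]
    exact mul_nonneg (ha j).le (zero_le_one.trans (one_le_lorentz _ _))
  rw [← lintegral_deriv_exp_neg_sq B _ hB]
  refine lintegral_congr fun t => ?_
  rw [quad_gram_insertNth, Fin.sum_univ_succAbove _ i, ← lorentzB_apply]
  simp only [Fin.insertNth_apply_same, Fin.insertNth_apply_succAbove, map_add, map_smul,
    lorentzB_apply, (x i).2.1, smul_eq_mul, mul_one]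
  rfl

/-- The signed volume is a cocycle. -/
theorem sum_signedVol_eq_zero (x : Fin (n + 2) → Hyp n) :
    ∑ i : Fin (n + 2), (-1 : ℝ) ^ (i : ℕ) * signedVol (fun j => x (i.succAbove j)) = 0 := by
  set w : Fin (n + 2) → ℝ := fun i => (-1 : ℝ) ^ (i : ℕ) * vertexDet fun j => x (i.succAbove j)
  set f : Fin (n + 2) → (Fin (n + 2) → ℝ) → ℝ := fun i a =>
    2 * lorentz (x i).1 (∑ j, a j • (x j).1) * Real.exp (-quad (gram x) a)
  have hf : ∀ i, Continuous (f i) := fun i => by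
    simp only [f]; unfold lorentz; fun_prop
  have hf0 : ∀ i, 0 ≤ᵐ[volume.restrict (orthant (n + 2))] f i := fun i => by
    filter_upwards [ae_restrict_mem (measurableSet_orthant _)] with a ha
    have : 0 ≤ lorentz (x i).1 (∑ j, a j • (x j).1) := by
      rw [← lorentzB_apply, map_sum]
      refine Finset.sum_nonneg fun j _ => ?_
      rw [map_smul, smul_eq_mul, lorentzB_apply]
      exact mul_nonneg (ha j).le (zero_le_one.trans (one_le_lorentz _ _))
    simp only [f, Pi.zero_apply]
    positivity
  have hlint : ∀ i, ∫⁻ a in orthant (n + 2), ENNReal.ofReal (f i a) =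
      simplexMass (gram fun j => x (i.succAbove j)) * gaussMoment n := fun i =>
    (lintegral_orthant_partial x i).trans (lintegral_orthant_exp_quad (gram_pos _))
  have hint : ∀ i, IntegrableOn (f i) (orthant (n + 2)) := fun i => by
    refine ⟨(hf i).aestronglyMeasurable, ?_⟩
    rw [hasFiniteIntegral_iff_ofReal (hf0 i), hlint]
    exact ENNReal.mul_lt_top (simplexMass_gram_ne_top _).lt_top (gaussMoment_ne_top n).lt_top
  have hval : ∀ i, ∫ a in orthant (n + 2), f i a =
      (simplexMass (gram fun j => x (i.succAbove j))).toReal * (gaussMoment n).toReal := fun i => by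
    rw [integral_eq_lintegral_of_nonneg_ae (hf0 i) (hf i).aestronglyMeasurable, hlint,
      ENNReal.toReal_mul]
  -- Pairing the relation `∑ i, w i • (x i).1 = 0` with `∑ j, a j • (x j).1` shows that `q` has zero
  -- derivative in the direction `w`.
  have hzero : ∀ a, ∑ i, w i * f i a = 0 := fun a => by
    have h : ∑ i, w i * lorentz (x i).1 (∑ j, a j • (x j).1) = 0 := by
      generalize ∑ j, a j • (x j).1 = y
      have h : lorentz (∑ i, w i • (x i).1) y = 0 := by
        rw [sum_vertexDet_smul, ← lorentzB_apply, map_zero, LinearMap.zero_apply]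
      rw [← lorentzB_apply, map_sum, LinearMap.sum_apply] at h
      simpa only [map_smul, LinearMap.smul_apply, lorentzB_apply, smul_eq_mul] using h
    have h2 : ∑ i, w i * f i a =
        (∑ i, w i * lorentz (x i).1 (∑ j, a j • (x j).1)) * (2 * Real.exp (-quad (gram x) a)) := by
      rw [Finset.sum_mul]
      exact Finset.sum_congr rfl fun i _ => by simp only [f]; ring
    rw [h2, h, zero_mul]
  have hsum : ∑ i, w i * ∫ a in orthant (n + 2), f i a = 0 := by
    simp_rw [← integral_const_mul]
    rw [← integral_finsetSum _ fun i _ => (hint i).const_mul _]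
    simp_rw [hzero, integral_zero]
  have hg : (gaussMoment n).toReal ≠ 0 :=
    (ENNReal.toReal_pos (gaussMoment_ne_zero n) (gaussMoment_ne_top n)).ne'
  refine (mul_eq_zero.1 ?_).resolve_right hg
  rw [← hsum, Finset.sum_mul]
  refine Finset.sum_congr rfl fun i _ => ?_
  rw [hval, signedVol_eq]
  ring

end SignedVol

end HypVol

end

/-! ### Bounded cohomology of aspherical quotients and developing maps. -/

noncomputable section

namespace HypVol

/-! ## Tuples and singular simplices -/

section Tuples

theorem Fin.succAbove_succAbove_of_le {k : ℕ} {i j : Fin (k + 2)} (hij : i ≤ j)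
    (l : Fin (k + 1)) :
    j.succ.succAbove (i.succAbove l) = i.castSucc.succAbove (j.succAbove l) := by
  refine Fin.ext ?_
  rw [Fin.le_def] at hij
  simp only [Fin.succAbove, Fin.lt_def, Fin.val_castSucc, Fin.val_succ]
  split_ifs <;> simp only [Fin.val_castSucc, Fin.val_succ] at * <;> omega

theorem groupFace_groupFace (Y : Type*) (k : ℕ) (i j : Fin (k + 2)) (hij : i ≤ j)
    (s : Fin (k + 3) → Y) :
    groupFace Y k i (groupFace Y (k + 1) j.succ s) =
      groupFace Y k j (groupFace Y (k + 1) i.castSucc s) :=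
  funext fun l => congrArg s (Fin.succAbove_succAbove_of_le hij l)

theorem singularFace_singularFace (X : Type*) [TopologicalSpace X] (k : ℕ) (i j : Fin (k + 2))
    (hij : i ≤ j) (s : SingularSimplex X (k + 2)) :
    singularFace X k i (singularFace X (k + 1) j.succ s) =
      singularFace X k j (singularFace X (k + 1) i.castSucc s) := by
  refine ContinuousMap.ext fun t => congrArg s ?_
  change stdSimplex.map _ (stdSimplex.map _ t) = stdSimplex.map _ (stdSimplex.map _ t)
  rw [stdSimplex.map_comp_apply, stdSimplex.map_comp_apply]
  exact congrArg (fun f => stdSimplex.map f t) (funext (Fin.succAbove_succAbove_of_le hij))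

/-- The cone operators on tuples: an entry is prepended. -/
def tupleCone (Y G : Type*) [Group G] [MulAction G Y] :
    ConeSystem (S := fun k => Fin (k + 1) → Y) (groupFace Y) Y G where
  cone k q s := Fin.cons q s
  apex q := fun _ => q
  cone_smul k g q s := by
    refine funext fun i => ?_
    refine Fin.cases ?_ (fun j => ?_) i <;> rfl
  face_zero k q s := rfl
  face_succ k q i s := by
    refine funext fun l => ?_
    refine Fin.cases ?_ (fun j => ?_) l
    · simp [groupFace]
    · simp [groupFace, Fin.succ_succAbove_succ]
  face_one q s := by
    refine funext fun l => ?_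
    fin_cases l
    rfl

variable {X : Type*} [TopologicalSpace X]

/-- The vertices of a singular simplex. -/
def vertices (k : ℕ) (σ : SingularSimplex X k) : Fin (k + 1) → X :=
  fun i => σ (stdSimplex.vertex i)

theorem vertices_singularFace (k : ℕ) (i : Fin (k + 2)) (σ : SingularSimplex X (k + 1)) :
    vertices k (singularFace X k i σ) = groupFace X k i (vertices (k + 1) σ) :=
  funext fun _ => congrArg σ (stdSimplex.map_vertex _ _)

end Tuples

/-! ## Cones over singular simplices in a contractible space -/

section Cone

theorem stdSimplex_map_apply {A B : Type*} [Fintype A] [Fintype B] [DecidableEq B] (f : A → B)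
    (s : stdSimplex ℝ A) (b : B) : stdSimplex.map f s b = ∑ a, if f a = b then s a else 0 := by
  rw [stdSimplex.map_coe, FunOnFinite.linearMap_apply_apply, Finset.sum_filter]

/-- The join of the vertex `0` with the opposite face. -/
def simplexJoin (k : ℕ) : C(unitInterval × stdSimplex ℝ (Fin (k + 1)), stdSimplex ℝ (Fin (k + 2))) where
  toFun x := ⟨Fin.cons x.1 fun i => (1 - x.1) * x.2 i, by
    refine ⟨fun i => ?_, ?_⟩
    · refine Fin.cases ?_ (fun j => ?_) i
      · exact x.1.2.1
      · exact mul_nonneg (sub_nonneg.2 x.1.2.2) (stdSimplex.zero_le x.2 j)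
    · simp [Fin.sum_univ_succ (n := k + 1), ← Finset.mul_sum, stdSimplex.sum_eq_one]⟩
  continuous_toFun := by
    refine Continuous.subtype_mk (continuous_pi fun i => ?_) _
    refine Fin.cases ?_ (fun j => ?_) i
    · simp only [Fin.cons_zero]; fun_prop
    · simp only [Fin.cons_succ]
      have : Continuous fun x : unitInterval × stdSimplex ℝ (Fin (k + 1)) => x.2 j :=
        (continuous_apply j).comp (continuous_subtype_val.comp continuous_snd)
      fun_prop

@[simp] theorem simplexJoin_zero (k : ℕ) (x : unitInterval × stdSimplex ℝ (Fin (k + 1))) :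
    simplexJoin k x 0 = x.1 := rfl

@[simp] theorem simplexJoin_succ (k : ℕ) (x : unitInterval × stdSimplex ℝ (Fin (k + 1))) (i : Fin (k + 1)) :
    simplexJoin k x i.succ = (1 - x.1) * x.2 i := rfl

theorem stdSimplex_ext {A : Type*} [Fintype A] {s t : stdSimplex ℝ A} (h : ∀ a, s a = t a) :
    s = t := stdSimplex.ext (funext h)

theorem simplexJoin_surjective (k : ℕ) : Function.Surjective (simplexJoin k) := by
  intro t
  have hsum : t 0 + ∑ i : Fin (k + 1), t i.succ = 1 := by
    rw [← Fin.sum_univ_succ, stdSimplex.sum_eq_one]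
  have hnn : ∀ i : Fin (k + 1), 0 ≤ t i.succ := fun i => stdSimplex.zero_le t _
  by_cases h : t 0 = 1
  · refine ⟨(1, stdSimplex.vertex 0), stdSimplex_ext fun i => ?_⟩
    have h0 : ∑ i : Fin (k + 1), t i.succ = 0 := by linarith
    rw [Finset.sum_eq_zero_iff_of_nonneg fun i _ => hnn i] at h0
    refine Fin.cases ?_ (fun j => ?_) i
    · simp [h]
    · simp [h0 j (Finset.mem_univ j)]
  · have h1 : 1 - t 0 ≠ 0 := fun h' => h (by linarith)
    have h2 : 0 ≤ 1 - t 0 := sub_nonneg.2 (stdSimplex.le_one t 0)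
    refine ⟨(⟨t 0, stdSimplex.zero_le t 0, stdSimplex.le_one t 0⟩,
      ⟨fun i => t i.succ / (1 - t 0), fun i => div_nonneg (hnn i) h2, ?_⟩),
      stdSimplex_ext fun i => ?_⟩
    · rw [← Finset.sum_div, div_eq_one_iff_eq h1]
      linarith
    · refine Fin.cases rfl (fun j => ?_) i
      exact mul_div_cancel₀ _ h1

/-- By compactness: maps out of the larger simplex can be defined, continuously, on the cylinder
over the opposite face. -/
theorem isQuotientMap_simplexJoin (k : ℕ) : Topology.IsQuotientMap (simplexJoin k) :=
  (simplexJoin k).continuous.isClosedMap.isQuotientMap (simplexJoin k).continuous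
    (simplexJoin_surjective k)

theorem map_succ_eq_simplexJoin (k : ℕ) (u : stdSimplex ℝ (Fin (k + 1))) :
    stdSimplex.map (Fin.succAbove 0) u = simplexJoin k (0, u) := by
  refine stdSimplex_ext fun i => ?_
  rw [stdSimplex_map_apply]
  refine Fin.cases ?_ (fun j => ?_) i
  · simp
  · simp

theorem map_succ_succAbove_simplexJoin (k : ℕ) (i : Fin (k + 2)) (r : unitInterval)
    (u : stdSimplex ℝ (Fin (k + 1))) :
    stdSimplex.map i.succ.succAbove (simplexJoin k (r, u)) =
      simplexJoin (k + 1) (r, stdSimplex.map i.succAbove u) := by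
  refine stdSimplex_ext fun l => ?_
  rw [stdSimplex_map_apply, Fin.sum_univ_succ]
  refine Fin.cases ?_ (fun j => ?_) l
  · simp [Fin.succ_succAbove_succ]
  · simp [Fin.succ_succAbove_succ, stdSimplex_map_apply, Finset.mul_sum, (Fin.succ_ne_zero j).symm]

theorem map_one_eq_simplexJoin (t u : stdSimplex ℝ (Fin 1)) :
    stdSimplex.map (Fin.succAbove 1) t = simplexJoin 0 (1, u) := by
  refine stdSimplex_ext fun l => ?_
  have ht : t 0 = 1 := stdSimplex.eq_one_of_unique t 0
  have h0 : (Fin.succAbove 1 (0 : Fin 1) : Fin 2) = 0 := rfl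
  rw [stdSimplex_map_apply, Fin.sum_univ_succ, Fin.sum_univ_zero, ht, h0, add_zero]
  refine Fin.cases ?_ (fun j => ?_) l
  · rw [if_pos rfl, simplexJoin_zero]
    rfl
  · rw [if_neg (Fin.succ_ne_zero j).symm, simplexJoin_succ]
    simp

variable {X : Type*} [TopologicalSpace X] {z : X}

/-- The join identifies points only at parameter one, where the contraction is already constant. -/
theorem factorsThrough_simplexJoin (F : (ContinuousMap.id X).Homotopy (ContinuousMap.const X z))
    {k : ℕ} (σ : SingularSimplex X k) :
    Function.FactorsThrough
      (F.toContinuousMap.comp ((ContinuousMap.id unitInterval).prodMap σ)) (simplexJoin k) := by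
  rintro ⟨r, u⟩ ⟨r', u'⟩ h
  have h0 : r = r' := Subtype.ext (by
    simpa using congrArg (fun s : stdSimplex ℝ (Fin (k + 2)) => s 0) h)
  subst h0
  by_cases hr : r = 1
  · subst hr
    change F (1, σ u) = F (1, σ u')
    simp
  · have hr' : (1 - r : ℝ) ≠ 0 := fun h' => hr (Subtype.ext (by
      change (r : ℝ) = 1
      linarith))
    have hu : u = u' := stdSimplex_ext fun i => by
      have := congrArg (fun s : stdSimplex ℝ (Fin (k + 2)) => s i.succ) h
      exact mul_left_cancel₀ hr' this
    rw [hu]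

/-- The cone over a singular simplex, with respect to a contraction of the space. -/
def singularCone (F : (ContinuousMap.id X).Homotopy (ContinuousMap.const X z)) {k : ℕ}
    (σ : SingularSimplex X k) : SingularSimplex X (k + 1) :=
  (isQuotientMap_simplexJoin k).lift (F.toContinuousMap.comp ((ContinuousMap.id unitInterval).prodMap σ))
    (factorsThrough_simplexJoin F σ)

variable (F : (ContinuousMap.id X).Homotopy (ContinuousMap.const X z))

theorem singularCone_simplexJoin {k : ℕ} (σ : SingularSimplex X k) (r : unitInterval)
    (u : stdSimplex ℝ (Fin (k + 1))) : singularCone F σ (simplexJoin k (r, u)) = F (r, σ u) :=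
  DFunLike.congr_fun ((isQuotientMap_simplexJoin k).lift_comp
    (F.toContinuousMap.comp ((ContinuousMap.id unitInterval).prodMap σ)) (factorsThrough_simplexJoin F σ))
    (r, u)

theorem singularFace_zero_singularCone {k : ℕ} (σ : SingularSimplex X k) :
    singularFace X k 0 (singularCone F σ) = σ := by
  refine ContinuousMap.ext fun u => ?_
  change singularCone F σ (stdSimplex.map _ u) = σ u
  rw [map_succ_eq_simplexJoin, singularCone_simplexJoin]
  simp

theorem singularFace_succ_singularCone {k : ℕ} (i : Fin (k + 2)) (σ : SingularSimplex X (k + 1)) :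
    singularFace X (k + 1) i.succ (singularCone F σ) = singularCone F (singularFace X k i σ) := by
  refine ContinuousMap.ext fun t => ?_
  obtain ⟨⟨r, u⟩, rfl⟩ := simplexJoin_surjective k t
  change singularCone F σ (stdSimplex.map _ _) = _
  rw [map_succ_succAbove_simplexJoin, singularCone_simplexJoin, singularCone_simplexJoin]
  rfl

theorem singularFace_one_singularCone (σ : SingularSimplex X 0) :
    singularFace X 0 1 (singularCone F σ) = ContinuousMap.const _ z := by
  refine ContinuousMap.ext fun t => ?_
  change singularCone F σ (stdSimplex.map _ _) = z
  rw [map_one_eq_simplexJoin t t, singularCone_simplexJoin]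
  simp

variable (G : Type*) [Group G] [MulAction G X] [ContinuousConstSMul G X]

/-- The equivariant cone operators on the singular simplices of a contractible space. -/
def singularConeSystem : ConeSystem (S := SingularSimplex X) (singularFace X) G G where
  -- The contraction is not equivariant; conjugating it by the parameter `g` makes the family
  -- equivariant, with apex at `g • z`.
  cone k g σ := g • singularCone F (g⁻¹ • σ)
  apex g := g • ContinuousMap.const _ z
  cone_smul k h g σ := by
    rw [smul_eq_mul, mul_inv_rev, mul_smul, mul_smul, inv_smul_smul]
  face_zero k g σ := by
    change g • singularFace X k 0 (singularCone F (g⁻¹ • σ)) = σ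
    rw [singularFace_zero_singularCone, smul_inv_smul]
  face_succ k g i σ := congrArg (g • ·) (singularFace_succ_singularCone F i (g⁻¹ • σ))
  face_one g σ := congrArg (g • ·) (singularFace_one_singularCone F (g⁻¹ • σ))

end Cone

/-- The simplices with vertices in the orbit of the apex that are spanned by iterated cones. -/
def ConeSystem.span {S : ℕ → Type*} {G : Type*} [Group G] [∀ k, MulAction G (S k)]
    {face : ∀ k, Fin (k + 2) → S (k + 1) → S k} (c : ConeSystem face G G) :
    ∀ k, (Fin (k + 1) → G) → S k
  | 0, g => c.apex (g 0)
  | k + 1, g => c.cone k (g 0) (c.span k (Fin.tail g))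

section Span

variable {S : ℕ → Type*} {G : Type*} [Group G] [∀ k, MulAction G (S k)]
  {face : ∀ k, Fin (k + 2) → S (k + 1) → S k} (c : ConeSystem face G G)

/-- Makes `span` a simplicial map, so that pulling back along it gives a cochain map from simplices
to tuples. -/
theorem ConeSystem.face_span (k : ℕ) (i : Fin (k + 2)) (g : Fin (k + 2) → G) :
    face k i (c.span (k + 1) g) = c.span k (groupFace G k i g) := by
  induction k with
  | zero =>
    fin_cases i
    · exact c.face_zero 0 _ _
    · exact c.face_one _ _
  | succ k ih =>
    refine Fin.cases (c.face_zero _ _ _) (fun j => ?_) i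
    refine (c.face_succ k _ j _).trans ?_
    rw [ih]
    change _ = c.cone k (g (j.succ.succAbove 0)) (c.span k (Fin.tail (groupFace G (k + 1) j.succ g)))
    rw [Fin.succ_succAbove_zero]
    congr 2
    exact funext fun l => by simp [groupFace, Fin.tail, Fin.succ_succAbove_succ]

theorem ConeSystem.span_smul (hap : ∀ g h : G, c.apex (g * h) = g • c.apex h) (k : ℕ) (h : G)
    (g : Fin (k + 1) → G) : c.span k (h • g) = h • c.span k g := by
  induction k with
  | zero => exact hap _ _
  | succ k ih =>
    change c.cone k (h • g 0) (c.span k (h • Fin.tail g)) = _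
    rw [ih, c.cone_smul]
    rfl

end Span

/-! ## Lifting along covering maps -/

section Lift

variable {A E B : Type*} [TopologicalSpace A] [TopologicalSpace E] [TopologicalSpace B]

/-- The contraction of `A`, run backwards, is a homotopy from a constant map to `f`. A constant map
lifts, and covering maps lift homotopies; the end of the lifted homotopy is the required lift. -/
theorem exists_lift_of_contractibleSpace [ContractibleSpace A] {q : E → B} (hq : IsCoveringMap q)
    (hs : Function.Surjective q) (f : C(A, B)) : ∃ f' : C(A, E), ∀ a, q (f' a) = f a := by
  obtain ⟨a₀, ⟨F⟩⟩ := id_nullhomotopic A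
  obtain ⟨e, he⟩ := hs (f a₀)
  have h0 : ∀ a, (f.comp F.symm.toContinuousMap) (0, a) = q (ContinuousMap.const A e a) :=
    fun a => by
      change f (F.symm (0, a)) = q e
      rw [he, F.symm.apply_zero]
      rfl
  refine ⟨(hq.liftHomotopy _ _ h0).comp (.prodMk (.const A 1) (.id A)), fun a => ?_⟩
  have := congrFun (hq.liftHomotopy_lifts _ _ h0) (1, a)
  refine this.trans ?_
  change f (F.symm (1, a)) = f a
  rw [F.symm.apply_one]
  rfl

theorem exists_smul_eq_of_comp_eq [PreconnectedSpace A] [Nonempty A] {G : Type*} [Group G]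
    [MulAction G E] {q : C(E, B)} (hq : IsQuotientCoveringMap q G) {f f' : C(A, E)}
    (h : q.comp f = q.comp f') : ∃ g : G, ∀ a, g • f a = f' a := by
  have := hq.toContinuousConstSMul
  obtain ⟨a⟩ := ‹Nonempty A›
  obtain ⟨g, hg⟩ := hq.apply_eq_iff_mem_orbit.1 (DFunLike.congr_fun h a).symm
  refine ⟨g, fun b => congrFun (hq.isCoveringMap.eq_of_comp_eq (g₁ := fun b => g • f b)
    (g₂ := f') (by fun_prop) f'.continuous (funext fun b => ?_) a hg) b⟩
  exact (hq.map_smul g).trans (DFunLike.congr_fun h b)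

/-- A free action admits an equivariant map to the group. -/
theorem exists_equivariant_map (G X : Type*) [Group G] [MulAction G X] [IsCancelSMul G X] :
    ∃ φ : X → G, ∀ (g : G) (x : X), φ (g • x) = g * φ x := by
  have h : ∀ x : X, ∃ g : G, g • (Quotient.mk (MulAction.orbitRel G X) x).out = x := fun x => by
    have h1 : (MulAction.orbitRel G X) (Quotient.mk (MulAction.orbitRel G X) x).out x :=
      Quotient.exact (Quotient.out_eq _)
    obtain ⟨g, hg⟩ := (MulAction.orbitRel G X).symm h1
    exact ⟨g, hg⟩
  choose φ hφ using h
  refine ⟨φ, fun g x => ?_⟩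
  have h1 : Quotient.mk (MulAction.orbitRel G X) (g • x) = Quotient.mk (MulAction.orbitRel G X) x :=
    Quotient.sound ⟨g, rfl⟩
  refine IsCancelSMul.right_cancel _ _ (Quotient.mk (MulAction.orbitRel G X) x).out ?_
  rw [mul_smul, hφ x]
  have := hφ (g • x)
  rwa [h1] at this

end Lift

/-! ## Morphisms of augmented complexes -/

section AugMap

variable {S T : ℕ → Type*} {P G : Type*} [Group G] [MulAction G P]
  [∀ k, MulAction G (S k)] [∀ k, MulAction G (T k)]
  {faceS : ∀ k, Fin (k + 2) → S (k + 1) → S k} {faceT : ∀ k, Fin (k + 2) → T (k + 1) → T k}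

variable (G faceS faceT) in
/-- Equivariant bounded cochain maps that extend the identity on the augmentations. -/
structure AugMap where
  map : ∀ k, BddFun (S k) →L[ℝ] BddFun (T k)
  equivariant : ∀ k (g : G) f,
    map k (pullback (fun s => g • s) f) = pullback (fun t => g • t) (map k f)
  comm : ∀ k f, map (k + 1) (coboundary faceS k f) = coboundary faceT k (map k f)
  augmentation : ∀ (a : ℝ) (f : BddFun (S 0)), (∀ s, f s = a) → ∀ t, map 0 f t = a

theorem coboundary_pullback {S T : ℕ → Type*} {faceS : ∀ k, Fin (k + 2) → S (k + 1) → S k}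
    {faceT : ∀ k, Fin (k + 2) → T (k + 1) → T k} (Θ : ∀ k, T k → S k)
    (hΘ : ∀ k i t, Θ k (faceT k i t) = faceS k i (Θ (k + 1) t)) (k : ℕ) (f : BddFun (S k)) :
    coboundary faceT k (pullback (Θ k) f) = pullback (Θ (k + 1)) (coboundary faceS k f) :=
  BddFun.ext fun t => by simp [coboundary_apply, hΘ]

/-- The morphism induced by an equivariant simplicial map. -/
def AugMap.ofSimplicial (Θ : ∀ k, T k → S k)
    (hΘ : ∀ k i t, Θ k (faceT k i t) = faceS k i (Θ (k + 1) t))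
    (hsmul : ∀ k (g : G) t, Θ k (g • t) = g • Θ k t) : AugMap G faceS faceT where
  map k := pullbackL (Θ k)
  equivariant k g f := BddFun.ext fun t => by simp [hsmul]
  comm k f := (coboundary_pullback Θ hΘ k f).symm
  augmentation a f hf t := hf _

theorem AugMap.coboundary_map_eq_zero (u : AugMap G faceS faceT) {k : ℕ} {f : BddFun (S k)}
    (hf : coboundary faceS k f = 0) : coboundary faceT k (u.map k f) = 0 := by
  rw [← u.comm, hf, map_zero]

theorem AugMap.map_mem_invariants (u : AugMap G faceS faceT) {k : ℕ} {f : BddFun (S k)}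
    (hf : f ∈ invariants G (S k)) : u.map k f ∈ invariants G (T k) := fun g t => by
  have h := u.equivariant k g f
  have hfg : pullback (fun s => g • s) f = f := BddFun.ext fun s => hf g s
  rw [hfg] at h
  exact (congrArg (fun F : BddFun (T k) => F t) h).symm

/-- Two morphisms of augmented complexes agree on the invariant cocycles of positive degree, up to
coboundaries of invariant cochains. -/
theorem ConeSystem.exists_coboundary_eq_sub (c : ConeSystem faceS P G) (b : ∀ k, T k → P)
    (hb : ∀ k (g : G) t, b k (g • t) = g • b k t)
    (hface : ∀ k i (g : G) t, faceT k i (g • t) = g • faceT k i t)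
    (hdd : ∀ k (f : BddFun (T k)), coboundary faceT (k + 1) (coboundary faceT k f) = 0)
    (u u' : AugMap G faceS faceT)
    {k : ℕ} (f : BddFun (S (k + 1))) (hf : f ∈ invariants G (S (k + 1)))
    (hd : coboundary faceS (k + 1) f = 0) :
    ∃ h ∈ invariants G (T k), ∀ t,
      coboundary faceT k h t = u.map (k + 1) f t - u'.map (k + 1) f t := by
  obtain ⟨h, hh, he⟩ := c.exists_coboundary_eq b hb hface hdd (fun k => u.map k - u'.map k)
    (fun k g f => by
      rw [sub_apply, sub_apply, u.equivariant, u'.equivariant, map_sub])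
    (fun k f => by
      rw [sub_apply, sub_apply, u.comm, u'.comm, map_sub])
    (fun a f hf => BddFun.ext fun t => by
      rw [sub_apply, BddFun.sub_apply, u.augmentation a f hf, u'.augmentation a f hf,
        sub_self, BddFun.zero_apply]) f hf hd
  exact ⟨h, hh, fun t => by rw [he]; rfl⟩

end AugMap

/-! ## Isometries of quotients -/

/-- Maps that do not increase norms descend to maps of quotients with the same property; being
mutually inverse there, they are isometries. -/
theorem exists_quotient_isometry {V W : Type*} [SeminormedAddCommGroup V] [NormedSpace ℝ V]
    [SeminormedAddCommGroup W] [NormedSpace ℝ W] (P : Submodule ℝ V) (Q : Submodule ℝ W)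
    (f : V →ₗ[ℝ] W) (g : W →ₗ[ℝ] V) (hf : ∀ v, ‖f v‖ ≤ ‖v‖) (hg : ∀ w, ‖g w‖ ≤ ‖w‖)
    (hfP : P ≤ Q.comap f) (hgQ : Q ≤ P.comap g) (hgf : ∀ v, g (f v) - v ∈ P)
    (hfg : ∀ w, f (g w) - w ∈ Q) :
    ∃ r : (V ⧸ P) ≃ₗᵢ[ℝ] (W ⧸ Q),
      ∀ v, r (Submodule.Quotient.mk v) = Submodule.Quotient.mk (f v) := by
  have hle : ∀ x, ‖P.mapQ Q f hfP x‖ ≤ ‖x‖ := fun x => le_of_forall_pos_le_add fun ε hε => by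
    obtain ⟨v, rfl, hv⟩ := Submodule.Quotient.norm_mk_lt x hε
    exact (Submodule.Quotient.norm_mk_le Q (f v)).trans ((hf v).trans hv.le)
  have hle' : ∀ y, ‖Q.mapQ P g hgQ y‖ ≤ ‖y‖ := fun y => le_of_forall_pos_le_add fun ε hε => by
    obtain ⟨w, rfl, hw⟩ := Submodule.Quotient.norm_mk_lt y hε
    exact (Submodule.Quotient.norm_mk_le P (g w)).trans ((hg w).trans hw.le)
  have h1 : ∀ x, Q.mapQ P g hgQ (P.mapQ Q f hfP x) = x := fun x => by
    obtain ⟨v, rfl⟩ := Submodule.Quotient.mk_surjective P x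
    exact (Submodule.Quotient.eq P).2 (hgf v)
  have h2 : ∀ y, P.mapQ Q f hfP (Q.mapQ P g hgQ y) = y := fun y => by
    obtain ⟨w, rfl⟩ := Submodule.Quotient.mk_surjective Q y
    exact (Submodule.Quotient.eq Q).2 (hfg w)
  refine ⟨⟨LinearEquiv.ofLinearMap (P.mapQ Q f hfP) (Q.mapQ P g hgQ) (LinearMap.ext h2)
    (LinearMap.ext h1), fun x => le_antisymm (hle x) ?_⟩, fun v => rfl⟩
  have := hle' (P.mapQ Q f hfP x)
  rwa [h1] at this

/-! ## Bounded cohomology of an aspherical quotient -/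

section Aspherical

instance (k : ℕ) : ContractibleSpace (stdSimplex ℝ (Fin (k + 1))) :=
  (convex_stdSimplex ℝ (Fin (k + 1))).contractibleSpace ⟨_, single_mem_stdSimplex ℝ 0⟩

variable {G X M : Type*} [Group G] [TopologicalSpace X] [MulAction G X] [ContinuousConstSMul G X]
  [TopologicalSpace M] {p : C(X, M)}

theorem coboundary_coboundary_singular (k : ℕ) (f : BddFun (SingularSimplex X k)) :
    coboundary (S := SingularSimplex X) (singularFace X) (k + 1)
      (coboundary (S := SingularSimplex X) (singularFace X) k f) = 0 :=
  coboundary_coboundary (S := SingularSimplex X) (singularFace X) (singularFace_singularFace X) k f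

theorem coboundary_coboundary_tuple (Y : Type*) (k : ℕ) (f : BddFun (Fin (k + 1) → Y)) :
    coboundary (S := fun k => Fin (k + 1) → Y) (groupFace Y) (k + 1)
      (coboundary (S := fun k => Fin (k + 1) → Y) (groupFace Y) k f) = 0 :=
  coboundary_coboundary (S := fun k => Fin (k + 1) → Y) (groupFace Y) (groupFace_groupFace Y) k f

/-- The morphism induced by an equivariant map on the vertices of singular simplices. -/
def AugMap.ofVertexMap {Y : Type*} [MulAction G Y] (φ : X → Y)
    (hφ : ∀ (g : G) x, φ (g • x) = g • φ x) :
    AugMap G (S := fun k => Fin (k + 1) → Y) (T := SingularSimplex X) (groupFace Y)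
      (singularFace X) :=
  AugMap.ofSimplicial (S := fun k => Fin (k + 1) → Y) (T := SingularSimplex X)
    (fun k σ i => φ (vertices k σ i))
    (fun k i σ => by rw [vertices_singularFace]; rfl)
    (fun k g σ => funext fun i => hφ g (vertices k σ i))

/-- A morphism of resolutions, as a morphism of augmented complexes. -/
def ResolutionMap.toAugMap (ψ : ResolutionMap G X) :
    AugMap G (S := fun k => Fin (k + 1) → G) (T := SingularSimplex X) (groupFace G)
      (singularFace X) where
  map := ψ.map
  equivariant k g f := by simpa only [inv_inv] using ψ.equivariant k g⁻¹ f
  comm := ψ.comm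
  augmentation := ψ.augmentation

/-- The morphism of resolutions induced by an equivariant map to the group. -/
def ResolutionMap.ofEquivariantMap (φ : X → G) (hφ : ∀ (g : G) x, φ (g • x) = g • φ x) :
    ResolutionMap G X where
  map := (AugMap.ofVertexMap φ hφ).map
  equivariant k g f := (AugMap.ofVertexMap φ hφ).equivariant k g⁻¹ f
  comm := (AugMap.ofVertexMap φ hφ).comm
  augmentation := (AugMap.ofVertexMap φ hφ).augmentation

theorem singularFace_comp (k : ℕ) (i : Fin (k + 2)) (σ : SingularSimplex X (k + 1)) :
    p.comp (singularFace X k i σ) = singularFace M k i (p.comp σ) := rfl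

/-- Two lifts of a simplex differ by a deck transformation, so an invariant cochain does not see the
choice of `L`. -/
theorem pullback_lift_apply (hp : IsQuotientCoveringMap p G) {k : ℕ}
    {L : SingularSimplex M k → SingularSimplex X k} (hL : ∀ σ, p.comp (L σ) = σ)
    {f : BddFun (SingularSimplex X k)} (hf : f ∈ invariants G (SingularSimplex X k))
    (σ : SingularSimplex X k) : pullback L f (p.comp σ) = f σ := by
  obtain ⟨g, hg⟩ := exists_smul_eq_of_comp_eq hp (hL (p.comp σ))
  rw [pullback_apply, ← hf g]
  exact congrArg f (ContinuousMap.ext hg)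

theorem coboundary_pullback_lift (hp : IsQuotientCoveringMap p G)
    {L : ∀ k, SingularSimplex M k → SingularSimplex X k} (hL : ∀ k σ, p.comp (L k σ) = σ) {k : ℕ}
    {f : BddFun (SingularSimplex X k)} (hf : f ∈ invariants G (SingularSimplex X k)) :
    coboundary (S := SingularSimplex M) (singularFace M) k (pullback (L k) f) =
      pullback (L (k + 1)) (coboundary (S := SingularSimplex X) (singularFace X) k f) := by
  refine BddFun.ext fun σ => ?_
  rw [pullback_apply, coboundary_apply, coboundary_apply]
  refine Finset.sum_congr rfl fun i _ => ?_
  rw [← pullback_lift_apply hp (hL k) hf, singularFace_comp, hL]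

theorem exists_simplex_lift (hp : IsQuotientCoveringMap p G) (k : ℕ) (σ : SingularSimplex M k) :
    ∃ σ' : SingularSimplex X k, p.comp σ' = σ := by
  obtain ⟨σ', h⟩ := exists_lift_of_contractibleSpace hp.isCoveringMap hp.surjective σ
  exact ⟨σ', ContinuousMap.ext h⟩

theorem singularClass_eq_of_coboundary (hp : IsQuotientCoveringMap p G) {k : ℕ}
    {z z' : SingularCocycle M (k + 1)} {h : BddFun (SingularSimplex X k)}
    (hh : h ∈ invariants G (SingularSimplex X k))
    (he : ∀ σ, coboundary (S := SingularSimplex X) (singularFace X) k h σ =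
      z.1 (p.comp σ) - z'.1 (p.comp σ)) : singularClass z = singularClass z' := by
  choose L hL using exists_simplex_lift hp
  refine (Submodule.Quotient.eq _).2 ⟨pullback (L k) h, trivial, ?_⟩
  rw [coboundary_pullback_lift hp hL hh]
  refine BddFun.ext fun σ => ?_
  rw [pullback_apply, he, hL]
  rfl

theorem smul_singularFace (k : ℕ) (i : Fin (k + 2)) (g : G) (σ : SingularSimplex X (k + 1)) :
    singularFace X k i (g • σ) = g • singularFace X k i σ := rfl

variable (X) in
-- One resolution map suffices: by the fundamental lemma any other one changes the image of a
-- cocycle only by the coboundary of an invariant cochain.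
theorem isCanonical_of_induces_ofEquivariantMap (hp : IsQuotientCoveringMap p G) (φ : X → G)
    (hφ : ∀ (g : G) x, φ (g • x) = g • φ x) {k : ℕ} {r : HbGroup G (k + 1) → HbSpace M (k + 1)}
    (hr : (ResolutionMap.ofEquivariantMap φ hφ).Induces p r) : IsCanonical p r := by
  refine ⟨⟨.ofEquivariantMap φ hφ⟩, fun ψ f => ?_⟩
  choose L hL using exists_simplex_lift hp
  obtain ⟨z₀, hz₀, hrz₀⟩ := hr f
  have hinv := ψ.toAugMap.map_mem_invariants f.2.1
  have hcoc := ψ.toAugMap.coboundary_map_eq_zero (LinearMap.mem_ker.1 f.2.2)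
  let z : SingularCocycle M (k + 1) := ⟨pullback (L (k + 1)) (ψ.map (k + 1) f.1), trivial, by
    refine LinearMap.mem_ker.2 ((coboundary_pullback_lift hp hL hinv).trans ?_)
    exact (congrArg (pullback (L (k + 1 + 1))) hcoc).trans (map_zero _)⟩
  have hz : ∀ σ : SingularSimplex X (k + 1), z.1 (p.comp σ) = ψ.map (k + 1) f.1 σ :=
    pullback_lift_apply hp (hL (k + 1)) hinv
  refine ⟨z, hz, hrz₀.trans ?_⟩
  obtain ⟨h, hh, he⟩ := (tupleCone G G).exists_coboundary_eq_sub
    (T := SingularSimplex X) (fun k σ => φ (vertices k σ 0)) (fun k g σ => hφ g _)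
    smul_singularFace coboundary_coboundary_singular (AugMap.ofVertexMap φ hφ) ψ.toAugMap
    f.1 f.2.1 (LinearMap.mem_ker.1 f.2.2)
  refine singularClass_eq_of_coboundary hp hh fun σ => ?_
  rw [he, hz, hz₀]
  rfl

set_option maxHeartbeats 2000000 in
-- The maps `u` (vertices sent to `G` by `φ`) and `v` (tuples spanned by cones) are pull-backs,
-- hence do not increase norms. Both composites extend the identity on augmentations, so by the
-- fundamental lemma they induce the identity on classes of positive degree.
theorem exists_canonical_isometry [ContractibleSpace X] (hp : IsQuotientCoveringMap p G) (k : ℕ) :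
    ∃ r : HbGroup G (k + 1) ≃ₗᵢ[ℝ] HbSpace M (k + 1), IsCanonical p r := by
  have := hp.isCancelSMul
  obtain ⟨φ, hφ⟩ := exists_equivariant_map G X
  choose L hL using exists_simplex_lift hp
  obtain ⟨z, ⟨F⟩⟩ := id_nullhomotopic X
  let c := singularConeSystem F G
  have hap : ∀ g h : G, c.apex (g * h) = g • c.apex h := fun g h => mul_smul g h _
  let u : AugMap G (S := fun k => Fin (k + 1) → G) (T := SingularSimplex X) (groupFace G)
    (singularFace X) := AugMap.ofVertexMap φ hφ
  let v : AugMap G (S := SingularSimplex X) (T := fun k => Fin (k + 1) → G) (singularFace X)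
    (groupFace G) := AugMap.ofSimplicial (S := SingularSimplex X) (T := fun k => Fin (k + 1) → G)
      c.span (fun k i g => (c.face_span k i g).symm) (c.span_smul hap)
  let uv : AugMap G (S := fun k => Fin (k + 1) → G) (T := fun k => Fin (k + 1) → G) (groupFace G)
    (groupFace G) :=
    { map := fun k => (v.map k).comp (u.map k)
      equivariant := fun k g f => (congrArg (v.map k) (u.equivariant k g f)).trans
        (v.equivariant k g _)
      comm := fun k f => (congrArg (v.map (k + 1)) (u.comm k f)).trans (v.comm k _)
      augmentation := fun a f hf => v.augmentation a _ (u.augmentation a f hf) }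
  let vu : AugMap G (S := SingularSimplex X) (T := SingularSimplex X) (singularFace X)
    (singularFace X) :=
    { map := fun k => (u.map k).comp (v.map k)
      equivariant := fun k g f => (congrArg (u.map k) (v.equivariant k g f)).trans
        (u.equivariant k g _)
      comm := fun k f => (congrArg (u.map (k + 1)) (v.comm k f)).trans (u.comm k _)
      augmentation := fun a f hf => u.augmentation a _ (v.augmentation a f hf) }
  let e : AugMap G (S := fun k => Fin (k + 1) → G) (T := fun k => Fin (k + 1) → G) (groupFace G)
    (groupFace G) := AugMap.ofSimplicial (S := fun k => Fin (k + 1) → G)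
      (T := fun k => Fin (k + 1) → G) (fun _ g => g) (fun _ _ _ => rfl) (fun _ _ _ => rfl)
  let e' : AugMap G (S := SingularSimplex X) (T := SingularSimplex X) (singularFace X)
    (singularFace X) := AugMap.ofSimplicial (S := SingularSimplex X) (T := SingularSimplex X)
      (fun _ σ => σ) (fun _ _ _ => rfl) (fun _ _ _ => rfl)
  -- invariant cochains on `X` and cochains on `M`
  have hdesc : ∀ k (f : BddFun (Fin (k + 1) → G)), f ∈ groupCochains G k →
      coboundary (S := SingularSimplex M) (singularFace M) k (pullback (L k) (u.map k f)) =
        pullback (L (k + 1)) (u.map (k + 1)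
          (coboundary (S := fun k => Fin (k + 1) → G) (groupFace G) k f)) := fun k f hf => by
    rw [coboundary_pullback_lift hp hL (u.map_mem_invariants hf), u.comm]
  have hasc : ∀ k (f : BddFun (SingularSimplex M k)),
      coboundary (S := SingularSimplex X) (singularFace X) k (pullback p.comp f) =
        pullback p.comp (coboundary (S := SingularSimplex M) (singularFace M) k f) :=
    coboundary_pullback (S := SingularSimplex M) (T := SingularSimplex X) (fun _ => p.comp)
      fun _ _ _ => rfl
  have hinvp : ∀ k (f : BddFun (SingularSimplex M k)),
      pullback p.comp f ∈ invariants G (SingularSimplex X k) := fun k f g σ =>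
    congrArg f (ContinuousMap.ext fun t => hp.map_smul g)
  have hpd : ∀ k (f : BddFun (SingularSimplex X k)), f ∈ invariants G (SingularSimplex X k) →
      pullback p.comp (pullback (L k) f) = f := fun k f hf =>
    BddFun.ext (pullback_lift_apply hp (hL k) hf)
  let A : GroupCocycle G (k + 1) →ₗ[ℝ] SingularCocycle M (k + 1) :=
    ((pullback (L (k + 1))).comp (u.map (k + 1)).toLinearMap).restrict fun f hf => ⟨trivial, by
      have h0 : coboundary (S := fun k => Fin (k + 1) → G) (groupFace G) (k + 1) f = 0 :=
        LinearMap.mem_ker.1 hf.2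
      refine LinearMap.mem_ker.2 ((hdesc _ f hf.1).trans ?_)
      rw [h0, map_zero, map_zero]⟩
  let B : SingularCocycle M (k + 1) →ₗ[ℝ] GroupCocycle G (k + 1) :=
    ((v.map (k + 1)).toLinearMap.comp (pullback p.comp)).restrict fun f hf =>
      ⟨v.map_mem_invariants (hinvp _ f), by
        have h0 : coboundary (S := SingularSimplex M) (singularFace M) (k + 1) f = 0 :=
          LinearMap.mem_ker.1 hf.2
        refine LinearMap.mem_ker.2 (v.coboundary_map_eq_zero ?_)
        rw [hasc, h0, map_zero]⟩
  obtain ⟨r, hr⟩ := exists_quotient_isometry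
    ((coboundaries (S := fun k => Fin (k + 1) → G) (groupFace G) (groupCochains G)
      (k + 1)).submoduleOf _)
    ((coboundaries (S := SingularSimplex M) (singularFace M) (fun _ => ⊤) (k + 1)).submoduleOf _)
    A B
    (fun f => (norm_pullback_le _ _).trans (norm_pullback_le _ _))
    (fun f => (norm_pullback_le _ _).trans (norm_pullback_le _ _))
    (by
      rintro f ⟨h, hh, he⟩
      exact ⟨pullback (L k) (u.map k h), trivial, (hdesc k h hh).trans
        (congrArg (fun f => pullback (L (k + 1)) (u.map (k + 1) f)) he)⟩)
    (by
      rintro f ⟨h, hh, he⟩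
      refine ⟨v.map k (pullback p.comp h), v.map_mem_invariants (hinvp _ h), ?_⟩
      refine (v.comm k _).symm.trans (congrArg (v.map (k + 1)) ?_)
      exact (hasc k h).trans (congrArg (pullback p.comp) he))
    (fun f => by
      obtain ⟨h, hh, he⟩ := (tupleCone G G).exists_coboundary_eq_sub
        (T := fun k => Fin (k + 1) → G) (fun k g => g 0) (fun k g σ => rfl)
        (fun _ _ _ _ => rfl) (coboundary_coboundary_tuple G) uv e
        f.1 f.2.1 (LinearMap.mem_ker.1 f.2.2)
      refine ⟨h, hh, BddFun.ext fun g => (he g).trans ?_⟩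
      refine congrArg (fun F : BddFun (SingularSimplex X (k + 1)) => v.map (k + 1) F g - f.1 g)
        (hpd _ _ (u.map_mem_invariants f.2.1)).symm)
    (fun f => by
      obtain ⟨h, hh, he⟩ := c.exists_coboundary_eq_sub
        (T := SingularSimplex X) (fun k σ => φ (vertices k σ 0)) (fun k g σ => hφ g _)
        smul_singularFace coboundary_coboundary_singular vu e'
        (pullback p.comp f.1) (hinvp _ _) (by
          rw [hasc, LinearMap.mem_ker.1 f.2.2, map_zero])
      refine ⟨pullback (L k) h, trivial, ?_⟩
      rw [coboundary_pullback_lift hp hL hh]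
      refine BddFun.ext fun σ => (he (L (k + 1) σ)).trans ?_
      exact congrArg (fun τ => u.map (k + 1) (v.map (k + 1) (pullback p.comp f.1))
        (L (k + 1) σ) - f.1 τ) (hL _ σ))
  refine ⟨r, isCanonical_of_induces_ofEquivariantMap X hp φ hφ fun f => ⟨A f, ?_, hr f⟩⟩
  exact pullback_lift_apply hp (hL (k + 1)) (u.map_mem_invariants f.2.1)

/-- The canonical map identifies the classes of cocycles that are defined by an invariant function
of the vertices. -/
theorem IsCanonical.groupClass_eq_singularClass (hp : IsQuotientCoveringMap p G) {k : ℕ}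
    {r : HbGroup G (k + 1) → HbSpace M (k + 1)} (hr : IsCanonical p r)
    {Y : Type*} [MulAction G Y] {w : BddFun (Fin (k + 2) → Y)}
    (hw : w ∈ invariants G (Fin (k + 2) → Y))
    (hdw : coboundary (S := fun k => Fin (k + 1) → Y) (groupFace Y) (k + 1) w = 0)
    (ξ : X → Y) (hξ : ∀ (g : G) x, ξ (g • x) = g • ξ x) (y : Y)
    (f : GroupCocycle G (k + 1)) (hf : ∀ g, f.1 g = w fun i => g i • y)
    (z : SingularCocycle M (k + 1))
    (hz : ∀ σ : SingularSimplex X (k + 1), z.1 (p.comp σ) = w fun i => ξ (vertices _ σ i)) :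
    r (groupClass f) = singularClass z := by
  have := hp.isCancelSMul
  obtain ⟨φ, hφ⟩ := exists_equivariant_map G X
  obtain ⟨z₀, hz₀, hrz₀⟩ := hr.2 (.ofEquivariantMap φ hφ) f
  rw [hrz₀]
  have hφy : ∀ (g : G) x, φ (g • x) • y = g • φ x • y := fun g x => by rw [hφ, mul_smul]
  -- The equivariant maps `x ↦ φ x • y` and `ξ` to `Y` induce two morphisms on bounded cochains of
  -- tuples in `Y`; their values on `w` represent the two classes.
  obtain ⟨h, hh, he⟩ := (tupleCone Y G).exists_coboundary_eq_sub
    (T := SingularSimplex X) (fun k σ => ξ (vertices k σ 0)) (fun k g σ => hξ g _)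
    smul_singularFace coboundary_coboundary_singular
    (AugMap.ofVertexMap (fun x => φ x • y) hφy) (AugMap.ofVertexMap ξ hξ) w hw hdw
  refine singularClass_eq_of_coboundary hp hh fun σ => ?_
  rw [he, hz, hz₀]
  exact congrArg (· - _) (hf _).symm

end Aspherical

/-! ## Rigidity of hyperbolic charts -/

section Rigidity

variable {n : ℕ} {H : Type*} [TopologicalSpace H]
  {I : ModelWithCorners ℝ (EuclideanSpace ℝ (Fin n)) H}
  {M : Type*} [TopologicalSpace M] [ChartedSpace H M]

theorem exists_hasFDerivAt_lorentz (a : Fin (n + 1) → ℝ) :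
    ∃ L : (Fin (n + 1) → ℝ) →L[ℝ] ℝ, HasFDerivAt (fun w => lorentz w w) L a ∧
      ∀ v, L v = 2 * lorentz a v := by
  have hc : ∀ i, HasFDerivAt (fun w : Fin (n + 1) → ℝ => w i)
      (ContinuousLinearMap.proj i : (Fin (n + 1) → ℝ) →L[ℝ] ℝ) a := fun i =>
    hasFDerivAt_apply i a
  refine ⟨_, ((hc 0).mul (hc 0)).sub
    (HasFDerivAt.fun_sum fun i (_ : i ∈ Finset.univ) => (hc (Fin.succ i)).mul (hc i.succ)),
    fun v => ?_⟩
  simp [lorentz, mul_sub, Finset.mul_sum, two_mul, Finset.sum_add_distrib]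

/-- An isometry is determined by the germ of its composition with a chart. -/
theorem HyperbolicChart.eq_of_eventually_smul_eq (c : HyperbolicChart I M) {x : M}
    (hx : x ∈ c.source) {g g' : IsoPlus n}
    (h : ∀ᶠ y in 𝓝 x, g • c.toFun y = g' • c.toFun y) : g = g' := by
  set f : M → Fin (n + 1) → ℝ := fun y => (c.toFun y).1
  have hf : MDifferentiableAt I 𝓘(ℝ, Fin (n + 1) → ℝ) f x :=
    (c.smooth.contMDiffAt (c.open_source.mem_nhds hx)).mdifferentiableAt (by simp)
  set D : EuclideanSpace ℝ (Fin n) →L[ℝ] Fin (n + 1) → ℝ :=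
    mfderiv I 𝓘(ℝ, Fin (n + 1) → ℝ) f x
  have hD : HasMFDerivAt I 𝓘(ℝ, Fin (n + 1) → ℝ) f x D := hf.hasMFDerivAt
  have hDinj : Function.Injective D := c.immersion x hx
  let A : IsoPlus n → (Fin (n + 1) → ℝ) →L[ℝ] Fin (n + 1) → ℝ := fun g =>
    LinearMap.toContinuousLinearMap g.1.toLinearMap
  have hA : ∀ g, HasMFDerivAt I 𝓘(ℝ, Fin (n + 1) → ℝ) (A g ∘ f) x ((A g).comp D) := fun g =>
    (A g).hasFDerivAt.hasMFDerivAt.comp x hD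
  have hgg : (A g).comp D = (A g').comp D :=
    hasMFDerivAt_unique (hA g) ((hA g').congr_of_eventuallyEq (h.mono fun y hy =>
      congrArg Subtype.val hy))
  -- Differentiating `lorentz (f y) (f y) = 1`: tangent vectors are orthogonal to the position
  -- vector.
  have hq : ∀ v, lorentz (f x) (D v) = 0 := fun v => by
    obtain ⟨L, hL, hLv⟩ := exists_hasFDerivAt_lorentz (f x)
    have h1 : HasMFDerivAt I 𝓘(ℝ, ℝ) ((fun w => lorentz w w) ∘ f) x (L.comp D) :=
      hL.hasMFDerivAt.comp x hD
    have h2 : ((fun w => lorentz w w) ∘ f) = fun _ => (1 : ℝ) := funext fun y => (c.toFun y).2.1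
    rw [h2] at h1
    have h3 : L.comp D = 0 := hasMFDerivAt_unique h1 (hasMFDerivAt_const (1 : ℝ) x)
    have h4 : L (D v) = 0 := DFunLike.congr_fun h3 v
    rw [hLv] at h4
    linarith
  -- the isometries agree on the span of the image point and the tangent space
  let W : Submodule ℝ (Fin (n + 1) → ℝ) := LinearMap.eqLocus g.1.toLinearMap g'.1.toLinearMap
  have hfW : f x ∈ W := congrArg Subtype.val h.self_of_nhds
  have hDW : LinearMap.range D.toLinearMap ≤ W := by
    rintro _ ⟨v, rfl⟩
    exact DFunLike.congr_fun hgg v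
  -- The position vector has norm one, so it is not tangent. Together with the `n`-dimensional
  -- tangent space it spans everything.
  have hlt : LinearMap.range D.toLinearMap < W := by
    refine lt_of_le_of_ne hDW fun he => ?_
    rw [← he] at hfW
    obtain ⟨v, hv⟩ := hfW
    have h1 := hq v
    rw [show D v = f x from hv] at h1
    exact one_ne_zero ((c.toFun x).2.1.symm.trans h1)
  have hrank : Module.finrank ℝ (LinearMap.range D.toLinearMap) = n := by
    rw [LinearMap.finrank_range_of_inj hDinj, finrank_euclideanSpace_fin]
  have hW : W = ⊤ := by
    refine Submodule.eq_top_of_finrank_eq (le_antisymm (Submodule.finrank_le W) ?_)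
    have := Submodule.finrank_lt_finrank_of_lt hlt
    rw [hrank] at this
    rw [Module.finrank_fin_fun]
    omega
  refine Subtype.ext (LinearEquiv.ext fun w => ?_)
  have : w ∈ W := hW ▸ Submodule.mem_top
  exact this

variable (𝓢 : HyperbolicStructure I M)

/-- The transition between two charts at a point of the overlap. -/
theorem HyperbolicStructure.exists_transition (c c' : 𝓢.charts) (x : M) :
    ∃ g : IsoPlus n, x ∈ c.1.source ∩ c'.1.source →
      ∀ᶠ y in 𝓝 x, c.1.toFun y = g • c'.1.toFun y := by
  by_cases hx : x ∈ c.1.source ∩ c'.1.source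
  · obtain ⟨g, hg⟩ := 𝓢.compat c' c'.2 c c.2 x hx.symm
    exact ⟨g, fun _ => hg⟩
  · exact ⟨1, fun h => (hx h).elim⟩

/-- The isometry by which two charts differ near a point of the overlap. -/
def HyperbolicStructure.transition (c c' : 𝓢.charts) (x : M) : IsoPlus n :=
  (𝓢.exists_transition c c' x).choose

variable {𝓢} in
theorem HyperbolicStructure.transition_spec {c c' : 𝓢.charts} {x : M}
    (hx : x ∈ c.1.source ∩ c'.1.source) :
    ∀ᶠ y in 𝓝 x, c.1.toFun y = 𝓢.transition c c' x • c'.1.toFun y :=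
  (𝓢.exists_transition c c' x).choose_spec hx

variable {𝓢} in
theorem HyperbolicStructure.transition_eq {c c' : 𝓢.charts} {x : M}
    (hx : x ∈ c.1.source ∩ c'.1.source) {g : IsoPlus n}
    (hg : ∀ᶠ y in 𝓝 x, c.1.toFun y = g • c'.1.toFun y) : 𝓢.transition c c' x = g := by
  refine c'.1.eq_of_eventually_smul_eq hx.2 ?_
  filter_upwards [transition_spec hx, hg] with y h1 h2
  rw [← h1, ← h2]

variable {𝓢} in
-- Near `x` the isometry at `x` also relates the charts, and rigidity makes it the only one. Local
-- constancy makes the coordinate changes of `germBundle` continuous for the discrete topology on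
-- the fiber.
theorem HyperbolicStructure.eventually_transition_eq {c c' : 𝓢.charts} {x : M}
    (hx : x ∈ c.1.source ∩ c'.1.source) :
    ∀ᶠ y in 𝓝 x, 𝓢.transition c c' y = 𝓢.transition c c' x := by
  filter_upwards [(transition_spec hx).eventually_nhds,
    (c.1.open_source.inter c'.1.open_source).mem_nhds hx] with y h1 h2
  exact transition_eq h2 h1

end Rigidity

/-! ## Developing maps -/

section Developing

variable {n : ℕ} {H : Type*} [TopologicalSpace H]
  {I : ModelWithCorners ℝ (EuclideanSpace ℝ (Fin n)) H}
  {M : Type*} [TopologicalSpace M] [ChartedSpace H M] (𝓢 : HyperbolicStructure I M)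
  {X : Type*} [TopologicalSpace X] (p : C(X, M))

/-- A map to hyperbolic space that is locally a chart followed by an isometry. -/
def IsLocallyChart (dev : X → Hyp n) : Prop :=
  ∀ c ∈ 𝓢.charts, ∀ x : X, p x ∈ c.source →
    ∃ g : IsoPlus n, ∀ᶠ y in 𝓝 x, dev y = g • c.toFun (p y)

/-- The bundle of germs of developing maps. -/
def germBundle [TopologicalSpace (IsoPlus n)] [DiscreteTopology (IsoPlus n)] :
    FiberBundleCore 𝓢.charts X (IsoPlus n) where
  baseSet c := p ⁻¹' c.1.source
  isOpen_baseSet c := c.1.open_source.preimage p.continuous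
  indexAt x := ⟨(𝓢.cover (p x)).choose, (𝓢.cover (p x)).choose_spec.1⟩
  mem_baseSet_at x := (𝓢.cover (p x)).choose_spec.2
  -- The fiber coordinate `v` in the chart `c` stands for the germ of `v • c`.
  coordChange c c' x v := v * 𝓢.transition c c' (p x)
  coordChange_self c x hx v := by
    rw [HyperbolicStructure.transition_eq ⟨hx, hx⟩ (g := 1)
      (Filter.Eventually.of_forall fun y => (one_smul _ _).symm), mul_one]
  continuousOn_coordChange c c' := by
    rintro ⟨x, v⟩ ⟨hx, -⟩
    refine ContinuousAt.continuousWithinAt ?_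
    have h1 : ∀ᶠ y in 𝓝 x, 𝓢.transition c c' (p y) = 𝓢.transition c c' (p x) :=
      p.continuous.continuousAt.eventually (HyperbolicStructure.eventually_transition_eq hx)
    have h2 : ∀ᶠ w in 𝓝 v, w = v := by rw [nhds_discrete]; rfl
    refine (continuousAt_const (y := v * 𝓢.transition c c' (p x))).congr ?_
    rw [nhds_prod_eq]
    filter_upwards [h1.prod_mk h2] with y hy
    rw [hy.1, hy.2]
  coordChange_comp c c' c'' x hx v := by
    rw [mul_assoc]
    congr 1
    refine (HyperbolicStructure.transition_eq ⟨hx.1.1, hx.2⟩ ?_).symm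
    filter_upwards [HyperbolicStructure.transition_spec (𝓢 := 𝓢) hx.1,
      HyperbolicStructure.transition_spec (𝓢 := 𝓢) ⟨hx.1.2, hx.2⟩] with y h1 h2
    rw [h1, h2, mul_smul]

/-- With discrete fibers the bundle of germs is a covering, and the identity of a contractible space
lifts to a section. Continuity of the section means that its coordinate in each chart is locally
constant. -/
theorem exists_isLocallyChart [ContractibleSpace X] :
    ∃ dev : X → Hyp n, IsLocallyChart 𝓢 p dev := by
  let : TopologicalSpace (IsoPlus n) := ⊥
  have : DiscreteTopology (IsoPlus n) := ⟨rfl⟩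
  let Z := germBundle 𝓢 p
  have hcov : IsCoveringMap (Bundle.TotalSpace.proj : Z.TotalSpace → X) :=
    FiberBundle.isCoveringMap
  have hsurj : Function.Surjective (Bundle.TotalSpace.proj : Z.TotalSpace → X) :=
    fun x => ⟨⟨x, (1 : IsoPlus n)⟩, rfl⟩
  obtain ⟨s, hs⟩ := exists_lift_of_contractibleSpace hcov hsurj (ContinuousMap.id X)
  have hs' : ∀ x, (s x).proj = x := hs
  let v : X → IsoPlus n := fun x => (s x).2
  let dev : X → Hyp n := fun x => v x • (Z.indexAt (s x).proj).1.toFun (p x)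
  refine ⟨dev, fun c hc x hx => ?_⟩
  let γ : X → IsoPlus n := fun y => (Z.localTriv ⟨c, hc⟩ (s y)).2
  have hγ : ∀ y, γ y = v y * 𝓢.transition (Z.indexAt (s y).proj) ⟨c, hc⟩ (p (s y).proj) :=
    fun y => rfl
  have hcont : ContinuousAt γ x := by
    refine continuous_snd.continuousAt.comp
      (((Z.localTriv ⟨c, hc⟩).continuousAt ?_).comp s.continuous.continuousAt)
    rw [FiberBundleCore.mem_localTriv_source, hs']
    exact hx
  refine ⟨γ x, ?_⟩
  have hpure : ∀ᶠ w in 𝓝 (γ x), w = γ x := by rw [nhds_discrete]; rfl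
  have hconst : ∀ᶠ y in 𝓝 x, γ y = γ x := hcont.eventually hpure
  filter_upwards [hconst, (c.open_source.preimage p.continuous).mem_nhds hx] with y hy hyc
  rw [← hy, hγ, mul_smul]
  have hmem : p y ∈ (Z.indexAt (s y).proj).1.source ∩ c.source := by
    refine ⟨?_, hyc⟩
    have := Z.mem_baseSet_at (s y).proj
    rw [hs'] at this ⊢
    exact this
  have hspec := (HyperbolicStructure.transition_spec (𝓢 := 𝓢) (c := Z.indexAt (s y).proj)
    (c' := ⟨c, hc⟩) hmem).self_of_nhds
  change v y • _ = _
  rw [hspec]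
  congr 3
  exact congrArg p (hs' y).symm

variable {𝓢 p}

/-- Since `p` is a local homeomorphism, the equality of germs descends to `M`, where the rigidity of
charts applies. -/
theorem IsLocallyChart.eq_of_eventually_smul_eq {dev : X → Hyp n} (hdev : IsLocallyChart 𝓢 p dev)
    (hp : IsLocalHomeomorph p) {x : X} {g g' : IsoPlus n}
    (h : ∀ᶠ y in 𝓝 x, g • dev y = g' • dev y) : g = g' := by
  obtain ⟨c, hc, hx⟩ := 𝓢.cover (p x)
  obtain ⟨a, ha⟩ := hdev c hc x hx
  have h1 : ∀ᶠ y in 𝓝 x, (g * a) • c.toFun (p y) = (g' * a) • c.toFun (p y) := by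
    filter_upwards [h, ha] with y h1 h2
    rw [mul_smul, mul_smul, ← h2, h1]
  have h2 : ∀ᶠ z in 𝓝 (p x), (g * a) • c.toFun z = (g' * a) • c.toFun z := by
    rw [← hp.map_nhds_eq x]
    exact h1
  exact mul_right_cancel (c.eq_of_eventually_smul_eq hx h2)

/-- Developing maps are unique up to an isometry. -/
theorem IsLocallyChart.exists_eq_smul [PreconnectedSpace X] [Nonempty X] {dev dev' : X → Hyp n}
    (hdev : IsLocallyChart 𝓢 p dev) (hdev' : IsLocallyChart 𝓢 p dev') (hp : IsLocalHomeomorph p) :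
    ∃ g : IsoPlus n, ∀ x, dev' x = g • dev x := by
  have hloc : ∀ x, ∃ g : IsoPlus n, ∀ᶠ y in 𝓝 x, dev' y = g • dev y := fun x => by
    obtain ⟨c, hc, hx⟩ := 𝓢.cover (p x)
    obtain ⟨a, ha⟩ := hdev c hc x hx
    obtain ⟨a', ha'⟩ := hdev' c hc x hx
    refine ⟨a' * a⁻¹, ?_⟩
    filter_upwards [ha, ha'] with y h1 h2
    rw [h1, h2, mul_smul, inv_smul_smul]
  choose g hg using hloc
  have hconst : IsLocallyConstant g := by
    refine (IsLocallyConstant.iff_eventually_eq g).2 fun x => ?_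
    filter_upwards [(hg x).eventually_nhds] with y hy
    refine hdev.eq_of_eventually_smul_eq hp (x := y) ?_
    filter_upwards [hy, hg y] with z h1 h2
    rw [← h1, ← h2]
  obtain ⟨x₀⟩ := ‹Nonempty X›
  refine ⟨g x₀, fun x => ?_⟩
  rw [hconst.apply_eq_of_preconnectedSpace x₀ x]
  exact (hg x).self_of_nhds

variable {G : Type*} [Group G] [MulAction G X]

/-- Precomposing `dev` with a deck transformation gives another developing map, which differs from
`dev` by a unique isometry. Existence defines `ρ`, and uniqueness makes it multiplicative. -/
theorem exists_isDevelopment [ContractibleSpace X] (hp : IsQuotientCoveringMap p G) :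
    ∃ (dev : X → Hyp n) (ρ : G →* IsoPlus n), IsDevelopment 𝓢 p dev ρ := by
  have := hp.toContinuousConstSMul
  have hl := hp.isCoveringMap.isLocalHomeomorph
  obtain ⟨dev, hdev⟩ := exists_isLocallyChart 𝓢 p
  have htrans : ∀ γ : G, IsLocallyChart 𝓢 p fun x => dev (γ • x) := fun γ c hc x hx => by
    obtain ⟨g, hg⟩ := hdev c hc (γ • x) (by rwa [hp.map_smul])
    refine ⟨g, ?_⟩
    filter_upwards [(continuous_const_smul γ).continuousAt.eventually hg] with y hy
    rw [hy, hp.map_smul]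
  choose ρ hρ using fun γ => hdev.exists_eq_smul (htrans γ) hl
  obtain ⟨x₀⟩ : Nonempty X := inferInstance
  refine ⟨dev, MonoidHom.mk' ρ fun γ δ => ?_, ⟨hdev, hρ⟩⟩
  refine hdev.eq_of_eventually_smul_eq hl (x := x₀) (Filter.Eventually.of_forall fun y => ?_)
  rw [← hρ, mul_smul, mul_smul, ← hρ, ← hρ]

end Developing

/-! ## Volume classes -/

section VolumeClass

section Cocycles

variable {G X M : Type*} [Group G] [TopologicalSpace X] [MulAction G X] [ContinuousConstSMul G X]
  [TopologicalSpace M] {p : C(X, M)} {Y : Type*} [MulAction G Y] {k : ℕ}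
  {w : BddFun (Fin (k + 1) → Y)}

theorem exists_singularCocycle (hp : IsQuotientCoveringMap p G)
    (hw : w ∈ invariants G (Fin (k + 1) → Y))
    (hdw : coboundary (S := fun k => Fin (k + 1) → Y) (groupFace Y) k w = 0)
    (ξ : X → Y) (hξ : ∀ (g : G) x, ξ (g • x) = g • ξ x) :
    ∃ z : SingularCocycle M k, ∀ σ : SingularSimplex X k,
      z.1 (p.comp σ) = w fun i => ξ (vertices _ σ i) := by
  choose L hL using exists_simplex_lift hp
  have hinv := (AugMap.ofVertexMap ξ hξ).map_mem_invariants hw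
  have hcoc := (AugMap.ofVertexMap ξ hξ).coboundary_map_eq_zero hdw
  refine ⟨⟨pullback (L k) ((AugMap.ofVertexMap ξ hξ).map k w), trivial, ?_⟩,
    pullback_lift_apply hp (hL k) hinv⟩
  refine LinearMap.mem_ker.2 ((coboundary_pullback_lift hp hL hinv).trans ?_)
  exact (congrArg (pullback (L (k + 1))) hcoc).trans (map_zero _)

theorem exists_groupCocycle (hw : w ∈ invariants G (Fin (k + 1) → Y))
    (hdw : coboundary (S := fun k => Fin (k + 1) → Y) (groupFace Y) k w = 0) (y : Y) :
    ∃ f : GroupCocycle G k, ∀ g, f.1 g = w fun i => g i • y := by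
  refine ⟨⟨pullback (fun g i => g i • y) w, fun g s => ?_, ?_⟩, fun g => rfl⟩
  · exact (congrArg w (funext fun i => mul_smul g (s i) y)).trans (hw g fun i => s i • y)
  · refine LinearMap.mem_ker.2 ?_
    refine (coboundary_pullback (S := fun k => Fin (k + 1) → Y) (T := fun k => Fin (k + 1) → G)
      (faceS := groupFace Y) (faceT := groupFace G) (fun k g i => g i • y) (fun _ _ _ => rfl) k w).trans ?_
    rw [hdw, map_zero]

end Cocycles

/-- The signed volume of geodesic simplices, as a bounded function. -/
theorem exists_bddFun_signedVol {n : ℕ} (hn : 2 ≤ n) :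
    ∃ w : BddFun (Fin (n + 1) → Hyp n), (∀ x, w x = signedVol x) ∧
      coboundary (S := fun k => Fin (k + 1) → Hyp n) (groupFace (Hyp n)) n w = 0 := by
  obtain ⟨C, hC⟩ := exists_bound_signedVol hn
  refine ⟨BddFun.mk signedVol C hC, fun x => rfl, BddFun.ext fun x => ?_⟩
  rw [coboundary_apply]
  exact sum_signedVol_eq_zero x

end VolumeClass

end HypVol

end

/-! ### The comparison of the volume classes. -/

open HypVol
theorem lemma2p2 {n : ℕ} (hn : 2 ≤ n)
    {H : Type*} [TopologicalSpace H] (I : ModelWithCorners ℝ (EuclideanSpace ℝ (Fin n)) H)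
    {M : Type*} [TopologicalSpace M] [T2Space M] [SecondCountableTopology M] [ConnectedSpace M]
    [ChartedSpace H M] [IsManifold I ∞ M]
    (𝓢 : HyperbolicStructure I M) (x₀ : M)
    {X : Type*} [TopologicalSpace X] [ContractibleSpace X]
    [MulAction (FundamentalGroup M x₀) X] [ContinuousConstSMul (FundamentalGroup M x₀) X]
    (p : C(X, M)) (hp : IsQuotientCoveringMap p (FundamentalGroup M x₀)) :
    ∃ (r : HbGroup (FundamentalGroup M x₀) n ≃ₗᵢ[ℝ] HbSpace M n)
      (volGp : HbGroup (FundamentalGroup M x₀) n) (vol : HbSpace M n),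
      IsCanonical p r ∧
      (∃ (dev : X → Hyp n) (ρ : FundamentalGroup M x₀ →* IsoPlus n), IsDevelopment 𝓢 p dev ρ) ∧
      (∀ (dev : X → Hyp n) (ρ : FundamentalGroup M x₀ →* IsoPlus n), IsDevelopment 𝓢 p dev ρ →
        (∀ o : Hyp n, IsGroupVolumeClass ρ o volGp) ∧ IsVolumeClass p dev vol) ∧
      r volGp = vol := by
  obtain ⟨k, rfl⟩ : ∃ k, n = k + 1 := ⟨n - 1, by omega⟩
  obtain ⟨r, hr⟩ := exists_canonical_isometry hp k
  obtain ⟨w, hw, hdw⟩ := exists_bddFun_signedVol hn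
  obtain ⟨dev₀, ρ₀, hdev₀⟩ := exists_isDevelopment (𝓢 := 𝓢) hp
  have hinv : ∀ ρ : FundamentalGroup M x₀ →* IsoPlus (k + 1),
      let := MulAction.compHom (Hyp (k + 1)) ρ
      w ∈ invariants (FundamentalGroup M x₀) (Fin (k + 2) → Hyp (k + 1)) := fun ρ g x =>
    (hw _).trans ((signedVol_smul (ρ g) x).trans (hw x).symm)
  -- The cocycle of one development serves all others: they differ by an isometry, which preserves
  -- signed volumes.
  obtain ⟨z, hz⟩ : ∃ z : SingularCocycle M (k + 1), ∀ σ : SingularSimplex X (k + 1),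
      z.1 (p.comp σ) = w fun i => dev₀ (vertices _ σ i) := by
    let := MulAction.compHom (Hyp (k + 1)) ρ₀
    exact exists_singularCocycle hp (hinv ρ₀) hdw dev₀ hdev₀.equivariant
  -- With the group class defined as the preimage, `r volGp = vol` is immediate; it remains to see
  -- that each `ρ` and base point `o` represents it.
  refine ⟨r, r.symm (singularClass z), singularClass z, hr, ⟨dev₀, ρ₀, hdev₀⟩,
    fun dev ρ hdev => ?_, r.apply_symm_apply _⟩
  obtain ⟨g, hg⟩ := IsLocallyChart.exists_eq_smul hdev₀.local_chart hdev.local_chart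
    hp.isCoveringMap.isLocalHomeomorph
  have hzdev : ∀ σ : SingularSimplex X (k + 1),
      z.1 (p.comp σ) = w fun i => dev (vertices _ σ i) := fun σ => by
    simp only [hz, hw, hg, signedVol_smul]
  refine ⟨fun o => ?_, z, fun σ => (hzdev σ).trans (hw _), rfl⟩
  -- Hyperbolic space becomes a `G`-set through `ρ`, and `dev` an equivariant map to it, so the
  -- general comparison applies with base point `o`.
  let := MulAction.compHom (Hyp (k + 1)) ρ
  obtain ⟨f, hf⟩ := exists_groupCocycle (hinv ρ) hdw o
  refine ⟨f, fun g => (hf g).trans (hw _), ?_⟩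
  rw [LinearIsometryEquiv.symm_apply_eq]
  exact (hr.groupClass_eq_singularClass hp (hinv ρ) hdw dev hdev.equivariant o f hf z hzdev).symm
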